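/- Let $n\ge 0$ be an integer, let $A$ and $B$ be Hermitian $n\times n$ complex matrices with $B$ invertible, and put $T(t)=\operatorname{tr}|A+tB|^{3}$ for $t\in\mathbb{R}$, where $|M|=(M^{*}M)^{1/2}$. Then: 1. The set $S$ of all real $t$ for which $A+tB$ is singular is finite, and $T$ is real analytic at every point of $\mathbb{R}\setminus S$. 2. $T^{(4)}(t)\ge 0$ for every $t\in\mathbb{R}\setminus S$. 3. For every $c\in S$ there are real numbers $C_c\ge 0$ and $D_c$ and a function $f_c$ that is $C^{4}$ near $c$ such that, for all $t$ in a neighbourhood of $c$, $$T(t)=C_c|t-c|^{3}+D_c|t-c|^{3}(t-c)+f_c(t).$$ 4. Consequently the fourth distributional derivative of $T$ on $\mathbb{R}$ is a non-negative, locally finite Borel measure, namely $$\mu=T^{(4)}(t)\,dt+\sum_{c\in S}12\,C_c\,\delta_c ,$$ where $T^{(4)}$ is the pointwise derivative on $\mathbb{R}\setminus S$; that is, $T$ is locally integrable and $\int_{\mathbb{R}}T\varphi^{(4)}\,dt=\int_{\mathbb{R}}\varphi\,d\mu$ for every smooth compactly supported $\varphi:\mathbb{R}\to\mathbb{R}$.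 -/

import Mathlib

open MeasureTheory Filter
open scoped Topology ContDiff MatrixOrder ComplexOrder

/-- The real number `tr |M|³` of a complex square matrix, where `|M| = (M* M)^{1/2}` is the absolute
value of the continuous functional calculus. As `|M|³` is positive semidefinite its trace is real,
so that taking the real part only changes the type. -/
noncomputable def traceAbsCube {n : ℕ} (M : Matrix (Fin n) (Fin n) ℂ) : ℝ :=
  ((CFC.abs M ^ 3).trace).re

/-- The function `t ↦ tr |A + t B|³` of a real variable. -/
noncomputable def pencilTrace {n : ℕ} (A B : Matrix (Fin n) (Fin n) ℂ) (t : ℝ) : ℝ :=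
  traceAbsCube (A + t • B)

/-- The `k`-th distributional derivative of the locally integrable function `f` on `ℝ` is the
(non-negative, locally finite) Borel measure `μ`: one has
`(-1)ᵏ ∫ f φ⁽ᵏ⁾ = ∫ φ dμ` for all smooth compactly supported `φ`. -/
def HasDistribDerivMeasure (k : ℕ) (f : ℝ → ℝ) (μ : Measure ℝ) : Prop :=
  LocallyIntegrable f ∧ IsLocallyFiniteMeasure μ ∧
    ∀ φ : ℝ → ℝ, ContDiff ℝ ∞ φ → HasCompactSupport φ →
      (-1 : ℝ) ^ k * ∫ t, f t * iteratedDeriv k φ t = ∫ t, φ t ∂μ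

open Polynomial in
/-- The monic polynomial of degree `k` with the given lower coefficients. -/
noncomputable def monicOfCoeffs {R : Type*} [CommRing R] {k : ℕ} (q : Fin k → R) : R[X] :=
  X ^ k + ∑ i, C (q i) * X ^ (i : ℕ)

open Polynomial in
/-- The polynomial of degree less than `k` with the given coefficients. -/
noncomputable def polyOfCoeffs {R : Type*} [CommRing R] {k : ℕ} (q : Fin k → R) : R[X] :=
  ∑ i, C (q i) * X ^ (i : ℕ)

open Polynomial in
/-- A family of monic polynomials of degree `n` whose coefficients are analytic at `t₀`. -/
structure AnalyticMonicFamily {𝕜 : Type*} [RCLike 𝕜] (p : 𝕜 → 𝕜[X]) (n : ℕ) (t₀ : 𝕜) : Prop where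
  monic : ∀ t, (p t).Monic
  natDegree : ∀ t, (p t).natDegree = n
  analyticAt : ∀ i, AnalyticAt 𝕜 (fun t => (p t).coeff i) t₀

section Factorization

open Polynomial

section Algebra

variable {R : Type*} [CommRing R] {k l : ℕ}

theorem monicOfCoeffs_eq (q : Fin k → R) : monicOfCoeffs q = X ^ k + polyOfCoeffs q := rfl

theorem degree_polyOfCoeffs_lt (q : Fin k → R) : (polyOfCoeffs q).degree < k := by
  refine (degree_sum_le _ _).trans_lt ?_
  rw [Finset.sup_lt_iff (by exact WithBot.bot_lt_coe k)]
  intro i _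
  exact (degree_C_mul_X_pow_le _ _).trans_lt (by exact_mod_cast i.2)

theorem coeff_polyOfCoeffs (q : Fin k → R) (i : ℕ) :
    (polyOfCoeffs q).coeff i = ∑ j : Fin k, q j * (X ^ (j : ℕ) : R[X]).coeff i := by
  simp [polyOfCoeffs, coeff_X_pow]

theorem coeff_polyOfCoeffs_fin (q : Fin k → R) (i : Fin k) : (polyOfCoeffs q).coeff i = q i := by
  simp [coeff_polyOfCoeffs, coeff_X_pow, Fin.val_inj]

theorem monic_monicOfCoeffs (q : Fin k → R) : (monicOfCoeffs q).Monic :=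
  monic_X_pow_add (degree_polyOfCoeffs_lt q)

theorem degree_monicOfCoeffs [Nontrivial R] (q : Fin k → R) : (monicOfCoeffs q).degree = k := by
  rw [monicOfCoeffs_eq, degree_add_eq_left_of_degree_lt, degree_X_pow]
  rw [degree_X_pow]
  exact degree_polyOfCoeffs_lt q

theorem natDegree_monicOfCoeffs [Nontrivial R] (q : Fin k → R) :
    (monicOfCoeffs q).natDegree = k :=
  natDegree_eq_of_degree_eq_some (degree_monicOfCoeffs q)

theorem coeff_monicOfCoeffs_fin (q : Fin k → R) (i : Fin k) : (monicOfCoeffs q).coeff i = q i := by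
  rw [monicOfCoeffs_eq, coeff_add, coeff_polyOfCoeffs_fin, coeff_X_pow, if_neg i.2.ne, zero_add]

theorem eq_of_monic_of_coeff [Nontrivial R] {p q : R[X]} {n : ℕ} (hp : p.Monic) (hq : q.Monic)
    (hpn : p.natDegree = n) (hqn : q.natDegree = n) (h : ∀ i < n, p.coeff i = q.coeff i) :
    p = q := by
  ext i
  rcases lt_trichotomy i n with hi | rfl | hi
  · exact h i hi
  · rw [← hpn, hp.coeff_natDegree, hpn, ← hqn, hq.coeff_natDegree]
  · rw [coeff_eq_zero_of_natDegree_lt (hpn ▸ hi), coeff_eq_zero_of_natDegree_lt (hqn ▸ hi)]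

theorem monicOfCoeffs_coeff [Nontrivial R] {p : R[X]} (hp : p.Monic) (hk : p.natDegree = k) :
    monicOfCoeffs (fun i : Fin k => p.coeff i) = p :=
  eq_of_monic_of_coeff (monic_monicOfCoeffs _) hp (natDegree_monicOfCoeffs _) hk
    fun i hi => coeff_monicOfCoeffs_fin (fun i : Fin k => p.coeff i) ⟨i, hi⟩

theorem polyOfCoeffs_add_smul (q d : Fin k → R) (s : R) :
    monicOfCoeffs (q + s • d) = monicOfCoeffs q + C s * polyOfCoeffs d := by
  simp only [monicOfCoeffs, polyOfCoeffs, Pi.add_apply, Pi.smul_apply, smul_eq_mul, C_add, C_mul,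
    add_mul, Finset.sum_add_distrib, Finset.mul_sum, add_assoc, mul_assoc]

theorem eq_zero_of_mul_add_mul_eq_zero {K : Type*} [Field K] {q r u v : K[X]} (hqr : IsCoprime q r)
    (hu : u.degree < q.degree) (hv : v.degree < r.degree) (h : u * r + q * v = 0) :
    u = 0 ∧ v = 0 := by
  have h1 : q ∣ u * r := ⟨-v, by linear_combination h⟩
  have h2 : r ∣ q * v := ⟨-u, by linear_combination h⟩
  exact ⟨eq_zero_of_dvd_of_degree_lt (hqr.dvd_of_dvd_mul_right h1) hu,
    eq_zero_of_dvd_of_degree_lt (hqr.symm.dvd_of_dvd_mul_left h2) hv⟩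

end Algebra

variable {𝕜 : Type*} [RCLike 𝕜] {k l : ℕ}

/-- The lower coefficients of the product of two monic polynomials as a function of theirs. -/
noncomputable def mulCoeffs (x : (Fin k → 𝕜) × (Fin l → 𝕜)) : Fin (k + l) → 𝕜 :=
  fun m => (monicOfCoeffs x.1 * monicOfCoeffs x.2).coeff m

theorem contDiff_mulCoeffs : ContDiff 𝕜 ω (mulCoeffs (𝕜 := 𝕜) (k := k) (l := l)) := by
  rw [contDiff_pi]
  intro m
  simp only [mulCoeffs, coeff_mul, monicOfCoeffs_eq, coeff_add, coeff_polyOfCoeffs]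
  fun_prop

theorem fderiv_mulCoeffs_apply (x d : (Fin k → 𝕜) × (Fin l → 𝕜)) (m : Fin (k + l)) :
    fderiv 𝕜 mulCoeffs x d m =
      (polyOfCoeffs d.1 * monicOfCoeffs x.2 + monicOfCoeffs x.1 * polyOfCoeffs d.2).coeff m := by
  have h1 : HasFDerivAt mulCoeffs (fderiv 𝕜 mulCoeffs x) (x + (0 : 𝕜) • d) := by
    rw [zero_smul, add_zero]
    exact (contDiff_mulCoeffs.differentiable (by simp) x).hasFDerivAt
  have h2 : HasDerivAt (fun s : 𝕜 => x + s • d) d 0 := by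
    simpa using ((hasDerivAt_id (0 : 𝕜)).smul_const d).const_add x
  have h3 := hasDerivAt_pi.1 (h1.comp_hasDerivAt (0 : 𝕜) h2) m
  have h4 : (fun s : 𝕜 => (mulCoeffs ∘ fun s : 𝕜 => x + s • d) s m) = fun s : 𝕜 =>
      (monicOfCoeffs x.1 * monicOfCoeffs x.2).coeff m + s *
        (polyOfCoeffs d.1 * monicOfCoeffs x.2 + monicOfCoeffs x.1 * polyOfCoeffs d.2).coeff m +
        s ^ 2 * (polyOfCoeffs d.1 * polyOfCoeffs d.2).coeff m := by
    funext s
    simp only [mulCoeffs, Function.comp, Prod.fst_add, Prod.snd_add, Prod.smul_fst, Prod.smul_snd,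
      polyOfCoeffs_add_smul]
    rw [← coeff_C_mul, ← coeff_C_mul, ← coeff_add, ← coeff_add, C_pow]
    congr 1
    ring
  rw [h4] at h3
  have h5 := ((((hasDerivAt_id (0 : 𝕜)).mul_const
    ((polyOfCoeffs d.1 * monicOfCoeffs x.2 + monicOfCoeffs x.1 * polyOfCoeffs d.2).coeff m))
    |>.const_add ((monicOfCoeffs x.1 * monicOfCoeffs x.2).coeff m)).add
    ((hasDerivAt_pow 2 (0 : 𝕜)).mul_const ((polyOfCoeffs d.1 * polyOfCoeffs d.2).coeff m)))
  have h6 := h3.unique h5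
  simpa using h6

theorem injective_fderiv_mulCoeffs {x : (Fin k → 𝕜) × (Fin l → 𝕜)}
    (hx : IsCoprime (monicOfCoeffs x.1) (monicOfCoeffs x.2)) :
    Function.Injective (fderiv 𝕜 mulCoeffs x) := by
  rw [injective_iff_map_eq_zero]
  intro d hd
  have hq : (monicOfCoeffs x.1).degree = k := degree_monicOfCoeffs _
  have hr : (monicOfCoeffs x.2).degree = l := degree_monicOfCoeffs _
  have h1 : (polyOfCoeffs d.1).degree < (monicOfCoeffs x.1).degree :=
    hq ▸ degree_polyOfCoeffs_lt _
  have h2 : (polyOfCoeffs d.2).degree < (monicOfCoeffs x.2).degree :=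
    hr ▸ degree_polyOfCoeffs_lt _
  have hz : polyOfCoeffs d.1 * monicOfCoeffs x.2 + monicOfCoeffs x.1 * polyOfCoeffs d.2 = 0 := by
    ext m
    by_cases hm : m < k + l
    · have := congrFun hd ⟨m, hm⟩
      rw [fderiv_mulCoeffs_apply] at this
      simpa using this
    · rw [coeff_zero]
      refine coeff_eq_zero_of_degree_lt (lt_of_lt_of_le ?_ (Nat.cast_le.2 (not_lt.1 hm)))
      refine (degree_add_le _ _).trans_lt (max_lt ?_ ?_)
      · rw [degree_mul, hr, Nat.cast_add]
        exact WithBot.add_lt_add_right (by simp) (hq ▸ h1)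
      · rw [degree_mul, hq, Nat.cast_add]
        exact WithBot.add_lt_add_left (by simp) (hr ▸ h2)
  obtain ⟨e1, e2⟩ := eq_zero_of_mul_add_mul_eq_zero hx h1 h2 hz
  refine Prod.ext (funext fun i => ?_) (funext fun i => ?_)
  · simpa [e1] using (coeff_polyOfCoeffs_fin d.1 i).symm
  · simpa [e2] using (coeff_polyOfCoeffs_fin d.2 i).symm

theorem analyticAt_coeff_monicOfCoeffs {c : 𝕜 → Fin k → 𝕜} {t₀ : 𝕜} (hc : AnalyticAt 𝕜 c t₀)
    (i : ℕ) : AnalyticAt 𝕜 (fun t => (monicOfCoeffs (c t)).coeff i) t₀ := by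
  simp only [monicOfCoeffs_eq, coeff_add, coeff_polyOfCoeffs]
  have h : ∀ j, AnalyticAt 𝕜 (fun t => c t j) t₀ := fun j =>
    ((ContinuousLinearMap.proj (R := 𝕜) (φ := fun _ : Fin k => 𝕜) j).analyticAt _).comp hc
  exact analyticAt_const.add (Finset.analyticAt_fun_sum _ fun j _ => (h j).mul analyticAt_const)

theorem analyticMonicFamily_monicOfCoeffs {c : 𝕜 → Fin k → 𝕜} {t₀ : 𝕜}
    (hc : AnalyticAt 𝕜 c t₀) : AnalyticMonicFamily (fun t => monicOfCoeffs (c t)) k t₀ :=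
  ⟨fun _ => monic_monicOfCoeffs _, fun _ => natDegree_monicOfCoeffs _,
    analyticAt_coeff_monicOfCoeffs hc⟩

/-- A factorization into coprime monic factors at a point extends analytically. -/
theorem AnalyticMonicFamily.exists_factorization {p : 𝕜 → 𝕜[X]} {n : ℕ} {t₀ : 𝕜}
    (hp : AnalyticMonicFamily p n t₀) {q r : 𝕜[X]} (hq : q.Monic) (hr : r.Monic)
    (hqr : IsCoprime q r) (h : p t₀ = q * r) :
    ∃ Q R : 𝕜 → 𝕜[X], AnalyticMonicFamily Q q.natDegree t₀ ∧
      AnalyticMonicFamily R r.natDegree t₀ ∧ Q t₀ = q ∧ R t₀ = r ∧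
      ∀ᶠ t in 𝓝 t₀, p t = Q t * R t := by
  obtain ⟨k, hk⟩ : ∃ k, q.natDegree = k := ⟨_, rfl⟩
  obtain ⟨l, hl⟩ : ∃ l, r.natDegree = l := ⟨_, rfl⟩
  obtain rfl : n = k + l := by
    rw [← hp.natDegree t₀, h, hq.natDegree_mul hr, hk, hl]
  let x : (Fin k → 𝕜) × (Fin l → 𝕜) := (fun i => q.coeff i, fun i => r.coeff i)
  have hxq : monicOfCoeffs x.1 = q := monicOfCoeffs_coeff hq hk
  have hxr : monicOfCoeffs x.2 = r := monicOfCoeffs_coeff hr hl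
  have hinj := injective_fderiv_mulCoeffs (x := x) (by rwa [hxq, hxr])
  let e : ((Fin k → 𝕜) × (Fin l → 𝕜)) ≃L[𝕜] (Fin (k + l) → 𝕜) :=
    (LinearEquiv.ofInjectiveOfFinrankEq (fderiv 𝕜 mulCoeffs x : _ →ₗ[𝕜] _) hinj
      (by simp)).toContinuousLinearEquiv
  have he : (e : _ →L[𝕜] _) = fderiv 𝕜 mulCoeffs x := by
    ext <;> rfl
  have hcd : ContDiffAt 𝕜 ω (mulCoeffs (𝕜 := 𝕜) (k := k) (l := l)) x :=
    contDiff_mulCoeffs.contDiffAt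
  have hfd : HasFDerivAt mulCoeffs (e : _ →L[𝕜] _) x := by
    rw [he]
    exact (contDiff_mulCoeffs.differentiable (by simp) x).hasFDerivAt
  let c : 𝕜 → Fin (k + l) → 𝕜 := fun t i => (p t).coeff i
  have hc : AnalyticAt 𝕜 c t₀ := AnalyticAt.pi fun i => hp.analyticAt i
  have hx : mulCoeffs x = c t₀ := by
    funext m
    simp only [mulCoeffs, hxq, hxr, c, h]
  let g := hcd.localInverse hfd (by simp)
  have hg : AnalyticAt 𝕜 g (c t₀) := by
    rw [← hx]
    exact (hcd.to_localInverse hfd (by simp)).analyticAt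
  have hgx : g (c t₀) = x := by
    rw [← hx]
    exact hcd.localInverse_apply_image hfd (by simp)
  have hgc : AnalyticAt 𝕜 (fun t => g (c t)) t₀ := hg.comp hc
  have hright : ∀ᶠ y in 𝓝 (c t₀), mulCoeffs (g y) = y := by
    rw [← hx]
    exact (hcd.hasStrictFDerivAt' hfd (by simp)).eventually_right_inverse
  refine ⟨fun t => monicOfCoeffs (g (c t)).1, fun t => monicOfCoeffs (g (c t)).2, ?_, ?_, ?_, ?_,
    ?_⟩
  · rw [hk]
    exact analyticMonicFamily_monicOfCoeffs (analyticAt_fst.comp hgc)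
  · rw [hl]
    exact analyticMonicFamily_monicOfCoeffs (analyticAt_snd.comp hgc)
  · simp only [hgx, hxq]
  · simp only [hgx, hxr]
  · filter_upwards [hc.continuousAt.eventually hright] with t ht
    refine eq_of_monic_of_coeff (hp.monic t) ((monic_monicOfCoeffs _).mul (monic_monicOfCoeffs _))
      (hp.natDegree t) ?_ fun i hi => ?_
    · rw [(monic_monicOfCoeffs _).natDegree_mul (monic_monicOfCoeffs _), natDegree_monicOfCoeffs,
        natDegree_monicOfCoeffs]
    · exact (congrFun ht ⟨i, hi⟩).symm

end Factorization

section RealRooted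

open Polynomial

theorem Multiset.two_mul_coeff_prod_X_sub_C (s : Multiset ℝ) (n : ℕ) (hs : s.card = n + 2) :
    2 * ((s.map fun a => X - C a).prod).coeff n =
      s.sum ^ 2 - (s.map fun a => a ^ 2).sum := by
  induction s using Multiset.induction_on generalizing n with
  | empty => simp at hs
  | cons a s ih =>
    rw [Multiset.card_cons] at hs
    have hc : s.card = n + 1 := by lia
    have h1 : ((s.map fun a => X - C a).prod).coeff n = -s.sum := by
      have := multiset_prod_X_sub_C_coeff_card_pred s (by lia)
      rwa [hc, Nat.add_sub_cancel] at this
    rw [Multiset.map_cons, Multiset.prod_cons, sub_mul, coeff_sub, coeff_C_mul, h1,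
      Multiset.sum_cons, Multiset.map_cons, Multiset.sum_cons]
    cases n with
    | zero =>
      obtain ⟨b, rfl⟩ := Multiset.card_eq_one.1 hc
      simp
      ring
    | succ m =>
      rw [coeff_X_mul, mul_sub, ih m hc]
      ring

/-- In a real-rooted monic polynomial without second leading term, the squares of the roots are
controlled by the third leading coefficient. -/
theorem Polynomial.Splits.sq_root_le {p : ℝ[X]} (hs : p.Splits) (hm : p.Monic) {n : ℕ}
    (hn : p.natDegree = n + 2) (h1 : p.coeff (n + 1) = 0) :
    ∀ x ∈ p.roots, x ^ 2 ≤ -2 * p.coeff n := by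
  intro x hx
  have hc : p.roots.card = n + 2 := by rw [← hs.natDegree_eq_card_roots, hn]
  have hp := hs.eq_prod_roots_of_monic hm
  have h2 := Multiset.two_mul_coeff_prod_X_sub_C p.roots n hc
  rw [← hp] at h2
  have h3 : p.roots.sum = 0 := by
    have := multiset_prod_X_sub_C_coeff_card_pred p.roots (by lia)
    rw [hc, ← hp, show n + 2 - 1 = n + 1 from rfl, h1] at this
    linarith
  have h4 : x ^ 2 ≤ (p.roots.map fun a => a ^ 2).sum :=
    Multiset.single_le_sum (fun y hy => by
      obtain ⟨z, -, rfl⟩ := Multiset.mem_map.1 hy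
      positivity) _ (Multiset.mem_map_of_mem _ hx)
  rw [h3] at h2
  linarith

theorem AnalyticMonicFamily.analyticAt_eval {𝕜 : Type*} [RCLike 𝕜] {p : 𝕜 → 𝕜[X]} {n : ℕ} {t₀ : 𝕜}
    (hd : ∀ t, (p t).natDegree ≤ n) (ha : ∀ i, AnalyticAt 𝕜 (fun t => (p t).coeff i) t₀)
    {s : 𝕜 → 𝕜} (hs : AnalyticAt 𝕜 s t₀) : AnalyticAt 𝕜 (fun t => (p t).eval (s t)) t₀ := by
  have : (fun t => (p t).eval (s t)) =
      fun t => ∑ i ∈ Finset.range (n + 1), (p t).coeff i * s t ^ i := by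
    funext t
    exact eval_eq_sum_range' (Nat.lt_succ_of_le (hd t)) _
  rw [this]
  exact Finset.analyticAt_fun_sum _ fun i _ => (ha i).mul (hs.pow i)

theorem AnalyticMonicFamily.taylor {𝕜 : Type*} [RCLike 𝕜] {p : 𝕜 → 𝕜[X]} {n : ℕ} {t₀ : 𝕜}
    (hp : AnalyticMonicFamily p n t₀) {s : 𝕜 → 𝕜} (hs : AnalyticAt 𝕜 s t₀) :
    AnalyticMonicFamily (fun t => Polynomial.taylor (s t) (p t)) n t₀ where
  monic t := by
    rw [Monic, leadingCoeff_taylor]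
    exact hp.monic t
  natDegree t := by rw [natDegree_taylor, hp.natDegree]
  analyticAt i := by
    simp only [taylor_coeff]
    refine AnalyticMonicFamily.analyticAt_eval (n := n)
      (fun t => (natDegree_hasseDeriv_le _ _).trans ?_) (fun j => ?_) hs
    · rw [hp.natDegree]
      exact Nat.sub_le _ _
    · simp only [hasseDeriv_coeff]
      exact analyticAt_const.mul (hp.analyticAt _)

theorem Polynomial.taylor_coeff_pred {p : ℝ[X]} {n : ℕ} (hm : p.Monic)
    (hn : p.natDegree = n + 1) (s : ℝ) :
    (taylor s p).coeff n = p.coeff n + (n + 1) * s := by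
  rw [taylor_coeff, eval_eq_sum_range' (n := 2)]
  · have h1 : p.coeff (n + 1) = 1 := hn ▸ hm
    simp [Finset.sum_range_succ, hasseDeriv_coeff, add_comm 1 n, h1]
  · refine lt_of_le_of_lt (natDegree_hasseDeriv_le _ _) ?_
    rw [hn]
    lia

/-- Real-rootedness is a closed condition. -/
theorem AnalyticMonicFamily.splits_self {p : ℝ → ℝ[X]} {n : ℕ} {t₀ : ℝ}
    (hp : AnalyticMonicFamily p n t₀) (hs : ∀ᶠ t in 𝓝[≠] t₀, (p t).Splits) : (p t₀).Splits := by
  refine Splits.of_splits_map_of_injective (i := algebraMap ℝ ℂ) (algebraMap ℝ ℂ).injective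
    (IsAlgClosed.splits _) fun z hz => ?_
  by_contra hzr
  have him : z.im ≠ 0 := fun h => hzr ⟨z.re, by apply Complex.ext <;> simp [h]⟩
  have heval : ∀ t, ((p t).map (algebraMap ℝ ℂ)).eval z =
      ∑ i ∈ Finset.range (n + 1), ((p t).coeff i : ℂ) * z ^ i := fun t => by
    rw [eval_map, eval₂_eq_sum_range, hp.natDegree]
    rfl
  have hcont : ContinuousAt (fun t => ‖((p t).map (algebraMap ℝ ℂ)).eval z‖) t₀ := by
    simp only [heval]
    refine ContinuousAt.norm (tendsto_finsetSum _ fun i _ => ?_)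
    exact ((Complex.continuous_ofReal.continuousAt.comp
      (hp.analyticAt i).continuousAt).mul continuousAt_const)
  have hlow : ∀ᶠ t in 𝓝[≠] t₀, |z.im| ^ n ≤ ‖((p t).map (algebraMap ℝ ℂ)).eval z‖ := by
    filter_upwards [hs] with t ht
    have h1 := ht.eq_prod_roots_of_monic (hp.monic t)
    have h2 : ((p t).map (algebraMap ℝ ℂ)).eval z =
        ((p t).roots.map fun a : ℝ => z - a).prod := by
      conv_lhs => rw [h1]
      rw [eval_map, ← coe_eval₂RingHom, map_multiset_prod, Multiset.map_map]
      congr 1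
      refine Multiset.map_congr rfl fun a _ => ?_
      simp
    rw [h2, ← hp.natDegree t, ht.natDegree_eq_card_roots]
    generalize (p t).roots = s
    induction s using Multiset.induction_on with
    | empty => simp
    | cons a s ih =>
      rw [Multiset.card_cons, Multiset.map_cons, Multiset.prod_cons, norm_mul, pow_succ']
      refine mul_le_mul ?_ ih (by positivity) (norm_nonneg _)
      simpa using Complex.abs_im_le_norm (z - a)
  have h3 := ge_of_tendsto (hcont.tendsto.mono_left nhdsWithin_le_nhds) hlow
  have h4 : ((p t₀).map (algebraMap ℝ ℂ)).eval z = 0 := by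
    have := (mem_roots'.1 hz).2
    exact this
  rw [h4, norm_zero] at h3
  have : 0 < |z.im| ^ n := by positivity
  linarith

theorem AnalyticAt.exists_eq_pow_mul_of_bound {f : ℝ → ℝ} {t₀ : ℝ} (hf : AnalyticAt ℝ f t₀)
    {m : ℕ} {K : ℝ} (hb : ∀ᶠ t in 𝓝[≠] t₀, |f t| ≤ K * |t - t₀| ^ m) :
    ∃ g, AnalyticAt ℝ g t₀ ∧ ∀ᶠ t in 𝓝 t₀, f t = (t - t₀) ^ m * g t := by
  refine (natCast_le_analyticOrderAt hf).1 ?_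
  by_contra! hlt
  have hne : analyticOrderAt f t₀ ≠ ⊤ := (lt_top_of_lt hlt).ne
  obtain ⟨o, ho⟩ := ENat.ne_top_iff_exists.1 hne
  rw [← ho, Nat.cast_lt] at hlt
  obtain ⟨g, hg, hg0, hfg⟩ := (hf.analyticOrderAt_eq_natCast).1 ho.symm
  have hlim : Tendsto (fun t => |g t|) (𝓝[≠] t₀) (𝓝 |g t₀|) :=
    hg.continuousAt.abs.tendsto.mono_left nhdsWithin_le_nhds
  have hlim2 : Tendsto (fun t => K * |t - t₀| ^ (m - o)) (𝓝[≠] t₀) (𝓝 0) := by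
    have : ContinuousAt (fun t => K * |t - t₀| ^ (m - o)) t₀ := by fun_prop
    have h := this.tendsto.mono_left (nhdsWithin_le_nhds (s := {t₀}ᶜ))
    simpa [Nat.sub_ne_zero_of_lt hlt] using h
  have hle : |g t₀| ≤ 0 := by
    refine le_of_tendsto_of_tendsto hlim hlim2 ?_
    filter_upwards [hb, hfg.filter_mono nhdsWithin_le_nhds, self_mem_nhdsWithin] with t h1 h2 h3
    have hpos : 0 < |t - t₀| := abs_pos.2 (sub_ne_zero.2 h3)
    rw [h2, smul_eq_mul, abs_mul, abs_pow] at h1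
    refine le_of_mul_le_mul_left (h1.trans_eq ?_) (pow_pos hpos o)
    rw [mul_left_comm, ← pow_add, Nat.add_sub_cancel' hlt.le]
  exact hg0 (abs_nonpos_iff.1 hle)

theorem even_of_pow_mul_nonneg {u : ℝ → ℝ} {t₀ : ℝ} (hu : ContinuousAt u t₀) (h0 : u t₀ ≠ 0)
    {m : ℕ} (h : ∀ᶠ t in 𝓝[≠] t₀, (t - t₀) ^ m * u t ≤ 0) : Even m := by
  by_contra hodd
  rw [Nat.not_even_iff_odd] at hodd
  have hr : ∀ᶠ t in 𝓝[>] t₀, (t - t₀) ^ m * u t ≤ 0 :=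
    h.filter_mono (nhdsWithin_mono _ fun t (ht : t₀ < t) => ht.ne')
  have hl : ∀ᶠ t in 𝓝[<] t₀, (t - t₀) ^ m * u t ≤ 0 :=
    h.filter_mono (nhdsWithin_mono _ fun t (ht : t < t₀) => ht.ne)
  have h1 : u t₀ ≤ 0 := by
    refine le_of_tendsto (hu.tendsto.mono_left (nhdsWithin_le_nhds (s := Set.Ioi t₀))) ?_
    filter_upwards [hr, self_mem_nhdsWithin] with t ht htt
    have : 0 < (t - t₀) ^ m := pow_pos (sub_pos.2 htt) m
    by_contra! hc
    nlinarith [mul_pos this hc]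
  have h2 : 0 ≤ u t₀ := by
    refine ge_of_tendsto (hu.tendsto.mono_left (nhdsWithin_le_nhds (s := Set.Iio t₀))) ?_
    filter_upwards [hl, self_mem_nhdsWithin] with t ht htt
    have : (t - t₀) ^ m < 0 := hodd.pow_neg (sub_neg.2 htt)
    by_contra! hc
    nlinarith [mul_pos_of_neg_of_neg this hc]
  exact h0 (le_antisymm h1 h2)

theorem Polynomial.list_prod_taylor (s : ℝ) (L : List ℝ) :
    taylor s (L.map fun a => X - C a).prod = (L.map fun a => X - C (a - s)).prod := by
  induction L with
  | nil => simp
  | cons a L ih =>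
    rw [List.map_cons, List.prod_cons, taylor_mul, ih, List.map_cons, List.prod_cons]
    congr 1
    simp [taylor_apply]
    ring

theorem Polynomial.list_prod_scaleRoots (s : ℝ) (L : List ℝ) :
    scaleRoots (L.map fun a => X - C a).prod s = (L.map fun a => X - C (s * a)).prod := by
  induction L with
  | nil => simp
  | cons a L ih =>
    rw [List.map_cons, List.prod_cons, mul_scaleRoots_of_noZeroDivisors, ih, List.map_cons,
      List.prod_cons, X_sub_C_scaleRoots, mul_comm a s]

/-- A real-rooted monic polynomial that is not a power of a linear one has a nontrivial
factorization into coprime factors. -/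
theorem Polynomial.Splits.exists_coprime_factorization {p : ℝ[X]} (hs : p.Splits) (hm : p.Monic)
    {n : ℕ} (hn : p.natDegree = n + 2) (h1 : p.coeff (n + 1) = 0) (h2 : p.coeff n ≠ 0) :
    ∃ q r : ℝ[X], q.Monic ∧ r.Monic ∧ IsCoprime q r ∧ p = q * r ∧ q.natDegree < n + 2 ∧
      r.natDegree < n + 2 := by
  obtain ⟨a, ha⟩ := Multiset.exists_mem_of_ne_zero (hs.roots_ne_zero (by lia))
  obtain ⟨r, hr, hnd⟩ := p.exists_eq_pow_rootMultiplicity_mul_and_not_dvd hm.ne_zero a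
  set m := p.rootMultiplicity a
  have hmpos : 0 < m := (rootMultiplicity_pos hm.ne_zero).2 (mem_roots'.1 ha).2
  have hqm : ((X - C a) ^ m).Monic := (monic_X_sub_C a).pow m
  have hrm : r.Monic := hqm.of_mul_monic_left (hr ▸ hm)
  have hqd : ((X - C a) ^ m).natDegree = m := by
    rw [(monic_X_sub_C a).natDegree_pow, natDegree_X_sub_C, mul_one]
  have hdeg : m + r.natDegree = n + 2 := by
    rw [← hn, hr, hqm.natDegree_mul hrm, hqd]
  refine ⟨(X - C a) ^ m, r, hqm, hrm, ?_, hr, ?_, by lia⟩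
  · exact IsCoprime.pow_left ((irreducible_X_sub_C a).coprime_iff_not_dvd.2 hnd)
  · rw [hqd]
    by_contra! hge
    have hr1 : r = 1 := hrm.natDegree_eq_zero.1 (by lia)
    have hmn : m = n + 2 := by lia
    have hp : p = ((Multiset.replicate (n + 2) a).map fun a => X - C a).prod := by
      rw [hr, hr1, hmn, mul_one, Multiset.map_replicate, Multiset.prod_replicate]
    have hsum : (Multiset.replicate (n + 2) a).sum = 0 := by
      have := multiset_prod_X_sub_C_coeff_card_pred (Multiset.replicate (n + 2) a) (by simp)
      rw [← hp, Multiset.card_replicate, show n + 2 - 1 = n + 1 from rfl, h1] at this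
      linarith
    have ha0 : a = 0 := by
      rw [Multiset.sum_replicate, smul_eq_zero] at hsum
      exact hsum.resolve_left (by lia)
    have h3 := Multiset.two_mul_coeff_prod_X_sub_C (Multiset.replicate (n + 2) a) n (by simp)
    rw [← hp, ha0] at h3
    simp at h3
    exact h2 h3

/-- **Rellich's theorem** for polynomials: the roots of a real-rooted monic polynomial with
coefficients analytic in one real parameter can be chosen analytic. -/
theorem AnalyticMonicFamily.exists_analytic_roots {p : ℝ → ℝ[X]} {n : ℕ} {t₀ : ℝ}
    (hp : AnalyticMonicFamily p n t₀) (hs : ∀ᶠ t in 𝓝[≠] t₀, (p t).Splits) :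
    ∃ L : List (ℝ → ℝ), (∀ f ∈ L, AnalyticAt ℝ f t₀) ∧
      ∀ᶠ t in 𝓝 t₀, p t = (L.map fun f => X - C (f t)).prod := by
  induction n using Nat.strong_induction_on generalizing p with
  | _ n ih =>
  obtain rfl | rfl | ⟨n, rfl⟩ : n = 0 ∨ n = 1 ∨ ∃ m, n = m + 2 := by
    rcases n with _ | _ | m
    · simp
    · simp
    · exact Or.inr (Or.inr ⟨m, rfl⟩)
  · exact ⟨[], by simp, Eventually.of_forall fun t => by
      simpa using (hp.monic t).natDegree_eq_zero.1 (hp.natDegree t)⟩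
  · refine ⟨[fun t => -(p t).coeff 0], List.forall_mem_singleton.2 (hp.analyticAt 0).neg,
      Eventually.of_forall fun t => ?_⟩
    simpa using (hp.monic t).eq_X_add_C (hp.natDegree t)
  -- remove the second leading coefficient
  let s : ℝ → ℝ := fun t => -(p t).coeff (n + 1) / ((n + 1 : ℕ) + 1)
  have hsa : AnalyticAt ℝ s t₀ := (hp.analyticAt (n + 1)).neg.div_const
  let q : ℝ → ℝ[X] := fun t => Polynomial.taylor (s t) (p t)
  have hq : AnalyticMonicFamily q (n + 2) t₀ := hp.taylor hsa
  have hpq : ∀ t, p t = Polynomial.taylor (-s t) (q t) := fun t => by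
    simp [q, taylor_taylor]
  have hq1 : ∀ t, (q t).coeff (n + 1) = 0 := fun t => by
    simp only [q, taylor_coeff_pred (hp.monic t) (hp.natDegree t), s]
    field_simp
    ring
  have hsq : ∀ᶠ t in 𝓝[≠] t₀, (q t).Splits := hs.mono fun t ht => ht.taylor _
  have hsq' : ∀ᶠ t in 𝓝 t₀, (q t).Splits := by
    rw [← nhdsNE_sup_pure, eventually_sup]
    exact ⟨hsq, hq.splits_self hsq⟩
  have hroot : ∀ t, (q t).Splits → ∀ x ∈ (q t).roots, x ^ 2 ≤ -2 * (q t).coeff n :=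
    fun t ht => ht.sq_root_le (hq.monic t) (hq.natDegree t) (hq1 t)
  suffices hL : ∃ L : List (ℝ → ℝ), (∀ f ∈ L, AnalyticAt ℝ f t₀) ∧
      ∀ᶠ t in 𝓝 t₀, q t = (L.map fun f => X - C (f t)).prod by
    obtain ⟨L, hLa, hL⟩ := hL
    refine ⟨L.map fun f t => f t + s t, ?_, ?_⟩
    · intro f hf
      obtain ⟨g, hg, rfl⟩ := List.mem_map.1 hf
      exact (hLa g hg).add hsa
    · filter_upwards [hL] with t ht
      have := list_prod_taylor (-s t) (L.map fun f => f t)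
      rw [List.map_map, List.map_map] at this
      rw [hpq, ht, List.map_map]
      simpa [Function.comp_def, sub_neg_eq_add] using this
  by_cases hzero : ∀ᶠ t in 𝓝 t₀, (q t).coeff n = 0
  · refine ⟨List.replicate (n + 2) fun _ => 0, fun f hf => ?_, ?_⟩
    · rw [List.eq_of_mem_replicate hf]
      exact analyticAt_const
    · filter_upwards [hzero, hsq'] with t h0 hst
      have hr : (q t).roots = Multiset.replicate (n + 2) 0 := by
        refine Multiset.eq_replicate.2 ⟨by rw [← hst.natDegree_eq_card_roots, hq.natDegree],
          fun x hx => ?_⟩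
        have := hroot t hst x hx
        rw [h0, mul_zero] at this
        exact pow_eq_zero_iff two_ne_zero |>.1 (le_antisymm this (sq_nonneg x))
      rw [hst.eq_prod_roots_of_monic (hq.monic t), hr]
      simp [pow_succ']
  -- extract the order of vanishing of the third leading coefficient
  obtain ⟨m, u, hua, hu0, hu⟩ :=
    (hq.analyticAt n).exists_eventuallyEq_pow_smul_nonzero_iff.2 hzero
  have hneg : ∀ᶠ t in 𝓝[≠] t₀, (t - t₀) ^ m * u t ≤ 0 := by
    filter_upwards [hsq, hu.filter_mono nhdsWithin_le_nhds] with t hst hut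
    rw [smul_eq_mul] at hut
    rw [← hut]
    obtain ⟨x, hx⟩ := Multiset.exists_mem_of_ne_zero
      (hst.roots_ne_zero (by rw [hq.natDegree]; lia))
    nlinarith [hroot t hst x hx, sq_nonneg x]
  obtain ⟨k, rfl⟩ := (even_of_pow_mul_nonneg hua.continuousAt hu0 hneg).two_dvd
  have hbound : ∃ K : ℝ, ∀ᶠ t in 𝓝[≠] t₀, ∀ x ∈ (q t).roots, |x| ≤ K * |t - t₀| ^ k := by
    obtain ⟨M, hM⟩ : ∃ M, ∀ᶠ t in 𝓝 t₀, |u t| ≤ M :=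
      ⟨|u t₀| + 1, (hua.continuousAt.abs.eventually_lt continuousAt_const
        (by simp)).mono fun t ht => ht.le⟩
    refine ⟨Real.sqrt (2 * M), ?_⟩
    filter_upwards [hsq, hu.filter_mono nhdsWithin_le_nhds, hM.filter_mono nhdsWithin_le_nhds]
      with t hst hut hMt x hx
    have hM0 : 0 ≤ M := (abs_nonneg _).trans hMt
    refine abs_le_of_sq_le_sq ?_ (by positivity)
    refine (hroot t hst x hx).trans ?_
    rw [hut, smul_eq_mul, mul_pow, Real.sq_sqrt (by positivity), ← pow_mul, mul_comm k 2, pow_mul,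
      pow_mul, sq_abs]
    have h5 : 0 ≤ ((t - t₀) ^ 2) ^ k := by positivity
    nlinarith [neg_abs_le (u t), mul_le_mul_of_nonneg_left hMt h5,
      mul_le_mul_of_nonneg_left (neg_abs_le (u t)) h5]
  obtain ⟨K, hK⟩ := hbound
  have hcoeff : ∀ i : Fin (n + 2), ∃ b, AnalyticAt ℝ b t₀ ∧
      ∀ᶠ t in 𝓝 t₀, (q t).coeff i = (t - t₀) ^ (k * (n + 2 - i)) * b t := by
    intro i
    refine (hq.analyticAt i).exists_eq_pow_mul_of_bound
      (K := K ^ (n + 2 - i : ℕ) * (n + 2).choose i) ?_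
    filter_upwards [hsq, hK] with t hst hKt
    have := coeff_le_of_roots_le (p := q t) (f := RingHom.id ℝ) (B := K * |t - t₀| ^ k) i
      (hq.monic t) (by simpa using hst) (by simpa using hKt)
    rw [Polynomial.map_id, hq.natDegree, Real.norm_eq_abs, mul_pow, ← pow_mul] at this
    linarith
  choose b hba hb using hcoeff
  let r : ℝ → ℝ[X] := fun t => monicOfCoeffs fun i => b i t
  have hr : AnalyticMonicFamily r (n + 2) t₀ :=
    analyticMonicFamily_monicOfCoeffs (AnalyticAt.pi hba)
  have hqr : ∀ᶠ t in 𝓝 t₀, q t = scaleRoots (r t) ((t - t₀) ^ k) := by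
    filter_upwards [eventually_all.2 hb] with t ht
    refine eq_of_monic_of_coeff (hq.monic t) ((monic_scaleRoots_iff _).2 (hr.monic t))
      (hq.natDegree t) (by rw [natDegree_scaleRoots, hr.natDegree]) fun i hi => ?_
    rw [coeff_scaleRoots, hr.natDegree, ht ⟨i, hi⟩, ← pow_mul, mul_comm,
      coeff_monicOfCoeffs_fin (fun i => b i t) ⟨i, hi⟩]
  have hsr : ∀ᶠ t in 𝓝[≠] t₀, (r t).Splits := by
    filter_upwards [hsq, hqr.filter_mono nhdsWithin_le_nhds, self_mem_nhdsWithin] with t hst ht h0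
    have h6 : r t = scaleRoots (q t) ((t - t₀) ^ k)⁻¹ := by
      rw [ht, ← scaleRoots_mul, mul_inv_cancel₀ (pow_ne_zero _ (sub_ne_zero.2 h0)), scaleRoots_one]
    rw [h6]
    exact hst.scaleRoots _
  have hcont : ∀ i, ContinuousAt (fun t => (r t).coeff i) t₀ := fun i =>
    (hr.analyticAt i).continuousAt
  have hr1 : (r t₀).coeff (n + 1) = 0 := by
    refine tendsto_nhds_unique_of_eventuallyEq (l := 𝓝[≠] t₀)
      ((hcont _).tendsto.mono_left nhdsWithin_le_nhds) tendsto_const_nhds ?_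
    filter_upwards [hqr.filter_mono nhdsWithin_le_nhds, self_mem_nhdsWithin] with t ht h0
    have := hq1 t
    rw [ht, coeff_scaleRoots] at this
    exact (mul_eq_zero.1 this).resolve_right (pow_ne_zero _ (pow_ne_zero _ (sub_ne_zero.2 h0)))
  have hr2 : (r t₀).coeff n = u t₀ := by
    refine tendsto_nhds_unique_of_eventuallyEq (l := 𝓝[≠] t₀)
      ((hcont _).tendsto.mono_left nhdsWithin_le_nhds)
      (hua.continuousAt.tendsto.mono_left nhdsWithin_le_nhds) ?_
    filter_upwards [hqr.filter_mono nhdsWithin_le_nhds, self_mem_nhdsWithin,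
      hu.filter_mono nhdsWithin_le_nhds] with t ht h0 hut
    rw [ht, coeff_scaleRoots, hr.natDegree, show n + 2 - n = 2 by lia, ← pow_mul, mul_comm k 2,
      smul_eq_mul, mul_comm] at hut
    exact mul_left_cancel₀ (pow_ne_zero _ (sub_ne_zero.2 h0)) hut
  obtain ⟨f₁, f₂, hm1, hm2, hcop, hprod, hd1, hd2⟩ := (hr.splits_self hsr).exists_coprime_factorization
    (hr.monic t₀) (hr.natDegree t₀) hr1 (hr2 ▸ hu0)
  obtain ⟨F₁, F₂, hF1, hF2, -, -, hF⟩ := hr.exists_factorization hm1 hm2 hcop hprod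
  have hs12 : ∀ᶠ t in 𝓝[≠] t₀, (F₁ t).Splits ∧ (F₂ t).Splits := by
    filter_upwards [hsr, hF.filter_mono nhdsWithin_le_nhds] with t hst ht
    rw [ht, splits_mul (hF1.monic t).ne_zero (hF2.monic t).ne_zero] at hst
    exact hst
  obtain ⟨L₁, hL1a, hL1⟩ := ih _ hd1 hF1 (hs12.mono fun t h => h.1)
  obtain ⟨L₂, hL2a, hL2⟩ := ih _ hd2 hF2 (hs12.mono fun t h => h.2)
  refine ⟨(L₁ ++ L₂).map fun f t => (t - t₀) ^ k * f t, ?_, ?_⟩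
  · intro f hf
    obtain ⟨g, hg, rfl⟩ := List.mem_map.1 hf
    have hga : AnalyticAt ℝ g t₀ := by
      rcases List.mem_append.1 hg with h | h
      · exact hL1a g h
      · exact hL2a g h
    exact ((analyticAt_id.sub analyticAt_const).pow k).mul hga
  · filter_upwards [hqr, hF, hL1, hL2] with t h1 h2 h3 h4
    have := list_prod_scaleRoots ((t - t₀) ^ k) ((L₁ ++ L₂).map fun f => f t)
    rw [List.map_map, List.map_map] at this
    rw [h1, h2, h3, h4, ← List.prod_append, ← List.map_append, List.map_map]
    simpa [Function.comp_def] using this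

end RealRooted

section RootSums

open Polynomial

theorem AnalyticMonicFamily.eventually_norm_roots_le {p : ℂ → ℂ[X]} {n : ℕ} {z₀ : ℂ}
    (hp : AnalyticMonicFamily p n z₀) :
    ∃ M : ℝ, ∀ᶠ ζ in 𝓝 z₀, ∀ z, (p ζ).IsRoot z → ‖z‖ ≤ M := by
  let f : ℂ → NNReal := fun ζ => ∑ i ∈ Finset.range n, ‖(p ζ).coeff i‖₊
  have hf : ContinuousAt f z₀ :=
    tendsto_finsetSum _ fun i _ => (hp.analyticAt i).continuousAt.nnnorm
  refine ⟨((f z₀ + 1 : NNReal) : ℝ) + 1, ?_⟩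
  filter_upwards [hf.eventually_lt continuousAt_const (lt_add_one (f z₀))] with ζ hζ z hz
  have h1 := hz.norm_lt_cauchyBound (hp.monic ζ).ne_zero
  have h2 : cauchyBound (p ζ) ≤ f z₀ + 1 + 1 := by
    rw [cauchyBound, (hp.monic ζ).leadingCoeff, nnnorm_one, div_one, hp.natDegree]
    gcongr
    refine (Finset.sup_le fun i hi => ?_).trans hζ.le
    exact Finset.single_le_sum (f := fun i => ‖(p ζ).coeff i‖₊) (fun _ _ => zero_le) hi
  exact_mod_cast (h1.trans_le h2).le

/-- The roots of a polynomial depend continuously on the coefficients: they stay in an open set. -/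
theorem AnalyticMonicFamily.eventually_roots_mem {p : ℂ → ℂ[X]} {n : ℕ} {z₀ : ℂ}
    (hp : AnalyticMonicFamily p n z₀) {U : Set ℂ} (hU : IsOpen U)
    (h : ∀ z, (p z₀).IsRoot z → z ∈ U) : ∀ᶠ ζ in 𝓝 z₀, ∀ z, (p ζ).IsRoot z → z ∈ U := by
  obtain ⟨M, hM⟩ := hp.eventually_norm_roots_le
  have hK : IsCompact (Metric.closedBall (0 : ℂ) M \ U) := (isCompact_closedBall 0 M).diff hU
  have hev : ∀ᶠ ζ in 𝓝 z₀, ∀ z ∈ Metric.closedBall (0 : ℂ) M \ U, (p ζ).eval z ≠ 0 := by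
    refine hK.eventually_forall_of_forall_eventually fun z hz => ?_
    have hc : ContinuousAt (fun y : ℂ × ℂ => (p y.1).eval y.2) (z₀, z) := by
      have : (fun y : ℂ × ℂ => (p y.1).eval y.2) =
          fun y : ℂ × ℂ => ∑ i ∈ Finset.range (n + 1), (p y.1).coeff i * y.2 ^ i := by
        funext y
        rw [eval_eq_sum_range, hp.natDegree]
      rw [this]
      refine tendsto_finsetSum _ fun i _ => ?_
      refine ContinuousAt.mul ?_ (continuousAt_snd.pow i)
      exact ContinuousAt.comp (f := Prod.fst) (x := (z₀, z)) (hp.analyticAt i).continuousAt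
        continuousAt_fst
    exact hc.eventually_ne fun h0 => hz.2 (h z h0)
  filter_upwards [hM, hev] with ζ h1 h2 z hz
  by_contra hzU
  exact h2 z ⟨by simpa using h1 z hz, hzU⟩ hz

theorem AnalyticMonicFamily.analyticAt_sum_roots {p : ℂ → ℂ[X]} {n : ℕ} {z₀ : ℂ}
    (hp : AnalyticMonicFamily p n z₀) : AnalyticAt ℂ (fun ζ => (p ζ).roots.sum) z₀ := by
  have h : (fun ζ => (p ζ).roots.sum) =
      fun ζ => -(if n = 0 then 0 else (p ζ).coeff (n - 1)) := by
    funext ζ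
    have := (IsAlgClosed.splits (p ζ)).nextCoeff_eq_neg_sum_roots_of_monic (hp.monic ζ)
    rw [nextCoeff, hp.natDegree] at this
    rw [this, neg_neg]
  rw [h]
  split_ifs
  · exact analyticAt_const
  · exact (hp.analyticAt _).neg

/-- The sum of the roots of `p` weighted with the side of the line `Im (c z) = 0` they lie on. -/
noncomputable def signedRootSum (c : ℂ) (p : ℂ[X]) : ℂ :=
  (p.roots.map fun z => ((SignType.sign (c * z).im : ℝ) : ℂ) * z).sum

theorem AnalyticMonicFamily.analyticAt_signedRootSum {p : ℂ → ℂ[X]} {n : ℕ} {z₀ : ℂ}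
    (hp : AnalyticMonicFamily p n z₀) (c : ℂ) (h : ∀ z, (p z₀).IsRoot z → (c * z).im ≠ 0) :
    AnalyticAt ℂ (fun ζ => signedRootSum c (p ζ)) z₀ := by
  classical
  let s := (p z₀).roots.filter fun z => 0 < (c * z).im
  let s' := (p z₀).roots.filter fun z => ¬ 0 < (c * z).im
  let q : ℂ[X] := (s.map fun a => X - C a).prod
  let r : ℂ[X] := (s'.map fun a => X - C a).prod
  have hq : q.Monic := monic_multiset_prod_of_monic _ _ fun a _ => monic_X_sub_C a
  have hr : r.Monic := monic_multiset_prod_of_monic _ _ fun a _ => monic_X_sub_C a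
  have hqroot : ∀ z, q.IsRoot z → 0 < (c * z).im := fun z hz => by
    have : z ∈ q.roots := (mem_roots hq.ne_zero).2 hz
    rw [roots_multiset_prod_X_sub_C] at this
    exact (Multiset.mem_filter.1 this).2
  have hrroot : ∀ z, r.IsRoot z → (c * z).im < 0 := fun z hz => by
    have : z ∈ r.roots := (mem_roots hr.ne_zero).2 hz
    rw [roots_multiset_prod_X_sub_C] at this
    have h1 := Multiset.mem_filter.1 this
    exact lt_of_le_of_ne (not_lt.1 h1.2) (h z (mem_roots'.1 h1.1).2)
  have hpqr : p z₀ = q * r := by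
    rw [(IsAlgClosed.splits (p z₀)).eq_prod_roots_of_monic (hp.monic z₀)]
    simp only [q, r, s, s']
    rw [← Multiset.prod_add, ← Multiset.map_add, Multiset.filter_add_not]
  have hcop : IsCoprime q r := by
    rw [Polynomial.isCoprime_iff_aeval_ne_zero_of_isAlgClosed ℂ ℂ]
    intro z
    by_contra! hz
    exact lt_asymm (hqroot z (by simpa using hz.1)) (hrroot z (by simpa using hz.2))
  obtain ⟨Q, R, hQ, hR, hQ0, hR0, hQR⟩ := hp.exists_factorization hq hr hcop hpqr
  have hcont : Continuous fun z : ℂ => (c * z).im := by fun_prop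
  have hQU := hQ.eventually_roots_mem (U := {z | 0 < (c * z).im})
    (isOpen_lt continuous_const hcont) (fun z hz => hqroot z (hQ0 ▸ hz))
  have hRU := hR.eventually_roots_mem (U := {z | (c * z).im < 0})
    (isOpen_lt hcont continuous_const) (fun z hz => hrroot z (hR0 ▸ hz))
  refine (hQ.analyticAt_sum_roots.sub hR.analyticAt_sum_roots).congr ?_
  filter_upwards [hQR, hQU, hRU] with ζ h1 h2 h3
  have h4 : ((Q ζ).roots.map fun z => ((SignType.sign (c * z).im : ℝ) : ℂ) * z) =
      (Q ζ).roots.map id := by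
    refine Multiset.map_congr rfl fun z hz => ?_
    have : 0 < (c * z).im := h2 z (mem_roots'.1 hz).2
    rw [sign_pos this]
    simp
  have h5 : ((R ζ).roots.map fun z => ((SignType.sign (c * z).im : ℝ) : ℂ) * z) =
      (R ζ).roots.map Neg.neg := by
    refine Multiset.map_congr rfl fun z hz => ?_
    have : (c * z).im < 0 := h3 z (mem_roots'.1 hz).2
    rw [sign_neg this]
    simp
  rw [signedRootSum, h1, roots_mul (mul_ne_zero (hQ.monic ζ).ne_zero (hR.monic ζ).ne_zero),
    Multiset.map_add, Multiset.sum_add, h4, h5, Multiset.map_id, Multiset.sum_map_neg']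
  simp [sub_eq_add_neg]

end RootSums

section Pick

open Complex

theorem Complex.abs_im_pow_le (u : ℂ) (k : ℕ) : |(u ^ (k + 1)).im| ≤ (k + 1) * ‖u‖ ^ k * |u.im| := by
  induction k with
  | zero => simp
  | succ k ih =>
    rw [pow_succ, mul_im]
    have h1 : |(u ^ (k + 1)).re * u.im| ≤ ‖u‖ ^ (k + 1) * |u.im| := by
      rw [abs_mul, ← norm_pow]
      exact mul_le_mul_of_nonneg_right (abs_re_le_norm _) (abs_nonneg _)
    have h2 : |(u ^ (k + 1)).im * u.re| ≤ (k + 1) * ‖u‖ ^ k * |u.im| * ‖u‖ := by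
      rw [abs_mul]
      exact mul_le_mul ih (abs_re_le_norm _) (abs_nonneg _) (by positivity)
    refine (abs_add_le _ _).trans ((add_le_add h1 h2).trans_eq ?_)
    push_cast
    ring

/-- A Phragmén–Lindelöf principle: a bounded analytic function on a half-plane has its imaginary
part bounded below by the bound on the boundary. -/
theorem Complex.le_im_of_le_im_boundary {N : ℂ → ℂ} {ε M b : ℝ}
    (hd : ∀ w : ℂ, ε ≤ w.im → DifferentiableAt ℂ N w) (hM : ∀ w : ℂ, ε ≤ w.im → ‖N w‖ ≤ M)
    (hb : ∀ w : ℂ, w.im = ε → b ≤ (N w).im) {w : ℂ} (hw : ε ≤ w.im) : b ≤ (N w).im := by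
  let f : ℂ → ℂ := fun z => exp (I * N (I * z + I * ε))
  have him : ∀ z : ℂ, (I * z + I * ε).im = z.re + ε := fun z => by simp
  have hnorm : ∀ z : ℂ, ‖f z‖ = Real.exp (-(N (I * z + I * ε)).im) := fun z => by
    simp [f, norm_exp]
  have hbd : ∀ z : ℂ, 0 ≤ z.re → ‖f z‖ ≤ Real.exp M := fun z hz => by
    rw [hnorm, Real.exp_le_exp]
    refine le_trans (neg_le_abs _) ((abs_im_le_norm _).trans (hM _ ?_))
    rw [him]
    linarith
  have hdiff : DiffContOnCl ℂ f {z | 0 < z.re} := by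
    refine DifferentiableOn.diffContOnCl fun z hz => ?_
    rw [closure_setOfPred_lt_re] at hz
    have hz' : 0 ≤ z.re := hz
    have h1 : DifferentiableAt ℂ N (I * z + I * ε) := hd _ (by rw [him]; linarith)
    have h2 : DifferentiableAt ℂ (fun z : ℂ => N (I * z + I * ε)) z :=
      DifferentiableAt.comp z h1 (by fun_prop)
    exact ((h2.const_mul I).cexp).differentiableWithinAt
  have key := PhragmenLindelof.right_half_plane_of_bounded_on_real (f := f) (C := Real.exp (-b))
    (z := -I * w - ε) hdiff ⟨1, by norm_num, 0, ?_⟩ ?_ ?_ (by simpa using hw)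
  · rw [hnorm, Real.exp_le_exp] at key
    have hz : I * (-I * w - ε) + I * ε = w := by
      linear_combination (-w) * I_sq
    rw [hz] at key
    linarith
  · refine Asymptotics.IsBigO.of_bound (Real.exp M) ?_
    rw [eventually_inf_principal]
    exact Eventually.of_forall fun z hz => by simpa using hbd z (le_of_lt hz)
  · refine isBoundedUnder_of_eventually_le (a := Real.exp M) ?_
    filter_upwards [eventually_ge_atTop 0] with x hx
    exact hbd x (by simpa using hx)
  · intro x
    rw [hnorm, Real.exp_le_exp]
    have := hb (I * (x * I) + I * ε) (by rw [him]; simp)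
    linarith

/-- Let `F` map the upper half-plane to itself, with real expansion
`F w = -(c₀ / w + c₁ + c₂ w + c₃ w² + c₄ w³ + ⋯)` at the origin, where `g w = c₃ + c₄ w + ⋯`.
If `F` is bounded away from the origin then `c₄ ≤ 0`. -/
theorem re_deriv_nonpos_of_im_nonneg {F g : ℂ → ℂ} {c₀ c₁ c₂ C : ℝ}
    (hF : ∀ w : ℂ, 0 < w.im → DifferentiableAt ℂ F w) (hpos : ∀ w : ℂ, 0 < w.im → 0 ≤ (F w).im)
    (hC : ∀ w : ℂ, 0 < w.im → ‖F w‖ ≤ C * (1 + ‖w‖⁻¹)) (hg : AnalyticAt ℂ g 0)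
    (hreal : ∀ᶠ x : ℝ in 𝓝 0, (g x).im = 0)
    (hFg : ∀ᶠ w in 𝓝 (0 : ℂ), 0 < w.im → F w = -(c₀ / w + c₁ + c₂ * w + w ^ 2 * g w)) :
    (deriv g 0).re ≤ 0 := by
  obtain ⟨K, s, hs, hK⟩ := (hg.contDiffAt (n := 1)).exists_lipschitzOnWith
  obtain ⟨δ₁, hδ₁, hball⟩ := Metric.eventually_nhds_iff.1 (hFg.and hs)
  obtain ⟨δ₂, hδ₂, hreal⟩ := Metric.eventually_nhds_iff.1 hreal
  set δ := min δ₁ δ₂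
  have hδ : 0 < δ := lt_min hδ₁ hδ₂
  have hC0 : 0 ≤ C := by
    have := (norm_nonneg _).trans (hC I (by simp))
    simp at this
    linarith
  let N : ℂ → ℂ := fun w => F w * w⁻¹ ^ 2 + c₀ * w⁻¹ ^ 3 + c₁ * w⁻¹ ^ 2 + c₂ * w⁻¹ ^ 1
  have hne : ∀ w : ℂ, 0 < w.im → w ≠ 0 := fun w hw h => by simp [h] at hw
  have hNg : ∀ w : ℂ, 0 < w.im → ‖w‖ < δ → N w = -g w := fun w hw hwδ => by
    have h1 := (hball (y := w) (by rw [dist_zero_right]; exact hwδ.trans_le (min_le_left _ _))).1 hw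
    have := hne w hw
    simp only [N, h1]
    field_simp
    ring
  have hNd : ∀ w : ℂ, 0 < w.im → DifferentiableAt ℂ N w := fun w hw => by
    have h1 := hF w hw
    have h2 : DifferentiableAt ℂ (fun w : ℂ => w⁻¹) w := differentiableAt_inv (hne w hw)
    fun_prop
  -- lower bound on horizontal lines
  obtain ⟨B, hB⟩ : ∃ B : ℝ, ∀ w : ℂ, 0 < w.im → w.im < δ / 2 → -(B * w.im) ≤ (N w).im := by
    refine ⟨max K (2 * δ⁻¹ ^ 3 * (C * (1 + δ⁻¹)) + 3 * δ⁻¹ ^ 4 * |c₀| + 2 * δ⁻¹ ^ 3 * |c₁| +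
      δ⁻¹ ^ 2 * |c₂|), fun w hw hw2 => ?_⟩
    rcases lt_or_ge ‖w‖ δ with hwδ | hwδ
    · rw [hNg w hw hwδ, neg_im]
      have hx : ‖(w.re : ℂ)‖ < δ := by
        rw [norm_real]
        exact (abs_re_le_norm w).trans_lt hwδ
      have hx0 : (g (w.re : ℂ)).im = 0 := hreal (by
        rw [dist_zero_right, ← norm_real]
        exact hx.trans_le (min_le_right _ _))
      have h1 := hK.dist_le_mul w
        ((hball (by rw [dist_zero_right]; exact hwδ.trans_le (min_le_left _ _))).2) w.re
        ((hball (by rw [dist_zero_right]; exact hx.trans_le (min_le_left _ _))).2)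
      have h2 : dist w (w.re : ℂ) = w.im := by
        rw [dist_eq_norm, show w - w.re = w.im * I by
          linear_combination -(re_add_im w)]
        simp [abs_of_pos hw]
      rw [h2, dist_eq_norm] at h1
      have h3 : (g w).im ≤ ‖g w - g w.re‖ := by
        have := (le_abs_self _).trans (abs_im_le_norm (g w - g w.re))
        rwa [sub_im, hx0, sub_zero] at this
      have h4 : (K : ℝ) * w.im ≤ max (K : ℝ) (2 * δ⁻¹ ^ 3 * (C * (1 + δ⁻¹)) + 3 * δ⁻¹ ^ 4 * |c₀| +
          2 * δ⁻¹ ^ 3 * |c₁| + δ⁻¹ ^ 2 * |c₂|) * w.im :=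
        mul_le_mul_of_nonneg_right (le_max_left _ _) hw.le
      linarith
    · have hw0 := hne w hw
      set u := w⁻¹ with hu
      have hun : ‖u‖ ≤ δ⁻¹ := by
        rw [hu, norm_inv]
        exact inv_anti₀ hδ hwδ
      have hnsq : normSq w = w.re ^ 2 + w.im ^ 2 := by rw [normSq_apply]; ring
      have hnpos : 0 < normSq w := normSq_pos.2 hw0
      have hnsqδ : δ ^ 2 ≤ normSq w := by
        rw [normSq_eq_norm_sq]
        exact pow_le_pow_left₀ hδ.le hwδ 2
      have huim : |u.im| ≤ δ⁻¹ ^ 2 * w.im := by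
        rw [hu, inv_im, abs_div, abs_neg, abs_of_pos hw, abs_of_pos hnpos, div_eq_inv_mul, inv_pow]
        exact mul_le_mul_of_nonneg_right (inv_anti₀ (by positivity) hnsqδ) hw.le
      have hpow : ∀ k : ℕ, |(u ^ (k + 1)).im| ≤ (k + 1) * δ⁻¹ ^ k * (δ⁻¹ ^ 2 * w.im) := fun k =>
        (abs_im_pow_le u k).trans (by gcongr)
      have hre : 0 ≤ (u ^ 2).re := by
        rw [hu, inv_pow, inv_re]
        refine div_nonneg ?_ (normSq_nonneg _)
        rw [sq, mul_re]
        nlinarith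
      have hFn : ‖F w‖ ≤ C * (1 + δ⁻¹) := (hC w hw).trans (by gcongr)
      have e1 : -(C * (1 + δ⁻¹) * (2 * δ⁻¹ * (δ⁻¹ ^ 2 * w.im))) ≤ (F w * u ^ 2).im := by
        rw [mul_im]
        have h1 := hpow 1
        norm_num at h1
        have h2 : |(F w).re * (u ^ 2).im| ≤ C * (1 + δ⁻¹) * (2 * δ⁻¹ * (δ⁻¹ ^ 2 * w.im)) := by
          rw [abs_mul]
          refine mul_le_mul ((abs_re_le_norm _).trans hFn) ?_ (abs_nonneg _) (by positivity)
          simpa using h1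
        have h3 := neg_abs_le ((F w).re * (u ^ 2).im)
        have h4 := mul_nonneg (hpos w hw) hre
        linarith
      have e2 : ∀ (c : ℝ) (k : ℕ), -(|c| * ((k + 1) * δ⁻¹ ^ k * (δ⁻¹ ^ 2 * w.im))) ≤
          ((c : ℂ) * u ^ (k + 1)).im := fun c k => by
        rw [im_ofReal_mul]
        have h2 : |c * (u ^ (k + 1)).im| ≤ |c| * ((k + 1) * δ⁻¹ ^ k * (δ⁻¹ ^ 2 * w.im)) := by
          rw [abs_mul]
          exact mul_le_mul_of_nonneg_left (hpow k) (abs_nonneg _)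
        have h3 := neg_abs_le (c * (u ^ (k + 1)).im)
        linarith
      have e3 := e2 c₀ 2
      have e4 := e2 c₁ 1
      have e5 := e2 c₂ 0
      have e6 : (2 * δ⁻¹ ^ 3 * (C * (1 + δ⁻¹)) + 3 * δ⁻¹ ^ 4 * |c₀| +
          2 * δ⁻¹ ^ 3 * |c₁| + δ⁻¹ ^ 2 * |c₂|) * w.im ≤
          max (K : ℝ) (2 * δ⁻¹ ^ 3 * (C * (1 + δ⁻¹)) + 3 * δ⁻¹ ^ 4 * |c₀| +
          2 * δ⁻¹ ^ 3 * |c₁| + δ⁻¹ ^ 2 * |c₂|) * w.im :=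
        mul_le_mul_of_nonneg_right (le_max_right _ _) hw.le
      simp only [N, ← hu, add_im]
      refine (neg_le_neg e6).trans ?_
      refine le_trans (le_of_eq ?_) (add_le_add (add_le_add (add_le_add e1 e3) e4) e5)
      push_cast
      ring
  have hNpos : ∀ w : ℂ, 0 < w.im → 0 ≤ (N w).im := by
    intro w hw
    have hlim : Tendsto (fun ε : ℝ => -(B * ε)) (𝓝[>] 0) (𝓝 0) := by
      have : ContinuousAt (fun ε : ℝ => -(B * ε)) 0 := by fun_prop
      simpa using this.tendsto.mono_left (nhdsWithin_le_nhds (s := Set.Ioi 0))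
    refine le_of_tendsto hlim ?_
    have hsmall : ∀ᶠ ε : ℝ in 𝓝[>] 0, ε < min (δ / 2) w.im :=
      (eventually_lt_nhds (lt_min (by positivity) hw)).filter_mono nhdsWithin_le_nhds
    filter_upwards [self_mem_nhdsWithin, hsmall] with ε hε hε2
    have hε0 : (0 : ℝ) < ε := hε
    have hle : ∀ w : ℂ, ε ≤ w.im → ‖w⁻¹‖ ≤ ε⁻¹ := fun w hw => by
      rw [norm_inv]
      exact inv_anti₀ hε0 (hw.trans ((le_abs_self _).trans (abs_im_le_norm w)))
    refine Complex.le_im_of_le_im_boundary (ε := ε)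
      (M := C * (1 + ε⁻¹) * ε⁻¹ ^ 2 + |c₀| * ε⁻¹ ^ 3 + |c₁| * ε⁻¹ ^ 2 + |c₂| * ε⁻¹ ^ 1)
      (fun w hw => hNd w (hε0.trans_le hw)) (fun w hw => ?_) (fun w hw => ?_)
      (hε2.le.trans (min_le_right _ _))
    · have h1 := hle w hw
      have h2 : ‖F w‖ ≤ C * (1 + ε⁻¹) := (hC w (hε0.trans_le hw)).trans (by
        rw [← norm_inv]
        gcongr)
      refine (norm_add_le _ _).trans (add_le_add ((norm_add_le _ _).trans (add_le_add
        ((norm_add_le _ _).trans (add_le_add ?_ ?_)) ?_)) ?_) <;>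
      · rw [norm_mul, norm_pow]
        try rw [norm_real, Real.norm_eq_abs]
        gcongr
    · have := hB w (hw ▸ hε0) (hw ▸ hε2.trans_le (min_le_left _ _))
      rwa [hw] at this
  -- conclusion at the origin
  have hg0 : (g 0).im = 0 := by simpa using hreal (y := 0) (by simpa using hδ₂)
  have hder := (hasDerivAt_iff_tendsto_slope.1 hg.differentiableAt.hasDerivAt)
  have hpath : Tendsto (fun y : ℝ => (y : ℂ) * I) (𝓝[>] 0) (𝓝[≠] 0) := by
    refine tendsto_nhdsWithin_iff.2 ⟨?_, ?_⟩
    · have : ContinuousAt (fun y : ℝ => (y : ℂ) * I) 0 := by fun_prop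
      simpa using this.tendsto.mono_left (nhdsWithin_le_nhds (s := Set.Ioi 0))
    · filter_upwards [self_mem_nhdsWithin] with y hy
      simpa using (ne_of_gt hy : y ≠ 0)
  have hlim := (continuous_re.tendsto _).comp (hder.comp hpath)
  refine le_of_tendsto hlim ?_
  have hsmall : ∀ᶠ y : ℝ in 𝓝[>] 0, y < δ :=
    (eventually_lt_nhds hδ).filter_mono nhdsWithin_le_nhds
  filter_upwards [self_mem_nhdsWithin, hsmall] with y hy hyδ
  have hy0 : (0 : ℝ) < y := hy
  have h1 : 0 < ((y : ℂ) * I).im := by simpa using hy0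
  have h2 := hNpos _ h1
  rw [hNg _ h1 (by simpa [abs_of_pos hy0] using hyδ), neg_im] at h2
  simp only [Function.comp, slope_def_field, sub_zero]
  have h3 : (g (y * I) - g 0) / (y * I) = -(I * (g (y * I) - g 0)) / y := by
    have : (y : ℂ) ≠ 0 := by exact_mod_cast hy0.ne'
    field_simp
    linear_combination (g (y * I) - g 0) * I_sq
  rw [h3, div_ofReal_re]
  refine div_nonpos_of_nonpos_of_nonneg ?_ hy0.le
  simp [hg0]
  linarith

end Pick

section TaylorCoefficients

theorem eq_zero_and_eventually_eq_zero_of_add_mul {c : ℝ} {g : ℝ → ℝ} (hg : ContinuousAt g 0)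
    (h : ∀ᶠ x in 𝓝 (0 : ℝ), c + x * g x = 0) : c = 0 ∧ ∀ᶠ x in 𝓝 (0 : ℝ), g x = 0 := by
  have hc : c = 0 := by simpa using h.self_of_nhds
  have hne : ∀ᶠ x in 𝓝[≠] (0 : ℝ), g x = 0 := by
    filter_upwards [h.filter_mono nhdsWithin_le_nhds, self_mem_nhdsWithin] with x hx h0
    rw [hc, zero_add] at hx
    exact (mul_eq_zero.1 hx).resolve_left h0
  have h0 : g 0 = 0 := tendsto_nhds_unique_of_eventuallyEq
    (hg.tendsto.mono_left (nhdsWithin_le_nhds (s := {0}ᶜ))) tendsto_const_nhds hne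
  refine ⟨hc, ?_⟩
  rw [← nhdsNE_sup_pure, eventually_sup]
  exact ⟨hne, h0⟩

/-- Taylor expansion of order four of an analytic function, in Horner form. -/
theorem AnalyticAt.exists_taylor_four {f : ℝ → ℝ} (hf : AnalyticAt ℝ f 0) :
    ∃ (a₀ a₁ a₂ a₃ : ℝ) (G : ℝ → ℝ), AnalyticAt ℝ G 0 ∧ G 0 = iteratedDeriv 4 f 0 / 24 ∧
      ∀ᶠ x in 𝓝 (0 : ℝ), f x = a₀ + x * (a₁ + x * (a₂ + x * (a₃ + x * G x))) := by
  obtain ⟨F, hF, h⟩ := hf.exists_eventuallyEq_sum_add_pow_mul 5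
  refine ⟨iteratedDeriv 0 f 0, iteratedDeriv 1 f 0, iteratedDeriv 2 f 0 / 2,
    iteratedDeriv 3 f 0 / 6, fun x => iteratedDeriv 4 f 0 / 24 + x * F x, ?_, by simp, ?_⟩
  · exact analyticAt_const.add (analyticAt_id.mul hF)
  · filter_upwards [h] with x hx
    rw [hx]
    simp only [Finset.sum_range_succ, Finset.sum_range_zero, Nat.factorial, smul_eq_mul]
    push_cast
    ring

theorem horner_four_unique {a₀ a₁ a₂ a₃ b₀ b₁ b₂ b₃ : ℝ} {G H : ℝ → ℝ} (hG : ContinuousAt G 0)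
    (hH : ContinuousAt H 0)
    (h : ∀ᶠ x in 𝓝 (0 : ℝ), a₀ + x * (a₁ + x * (a₂ + x * (a₃ + x * G x))) =
      b₀ + x * (b₁ + x * (b₂ + x * (b₃ + x * H x)))) :
    a₀ = b₀ ∧ a₁ = b₁ ∧ a₂ = b₂ ∧ a₃ = b₃ ∧ G 0 = H 0 := by
  have hd : ContinuousAt (fun x => G x - H x) 0 := hG.sub hH
  have h0 : ∀ᶠ x in 𝓝 (0 : ℝ), (a₀ - b₀) + x * ((a₁ - b₁) + x * ((a₂ - b₂) + x * ((a₃ - b₃) +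
      x * (G x - H x)))) = 0 := h.mono fun x hx => by linear_combination hx
  obtain ⟨e0, h1⟩ := eq_zero_and_eventually_eq_zero_of_add_mul (by fun_prop) h0
  obtain ⟨e1, h2⟩ := eq_zero_and_eventually_eq_zero_of_add_mul (by fun_prop) h1
  obtain ⟨e2, h3⟩ := eq_zero_and_eventually_eq_zero_of_add_mul (by fun_prop) h2
  obtain ⟨e3, h4⟩ := eq_zero_and_eventually_eq_zero_of_add_mul (by fun_prop) h3
  exact ⟨sub_eq_zero.1 e0, sub_eq_zero.1 e1, sub_eq_zero.1 e2, sub_eq_zero.1 e3,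
    sub_eq_zero.1 h4.self_of_nhds⟩

theorem AnalyticAt.dslope_self {𝕜 : Type*} [RCLike 𝕜] {f : 𝕜 → 𝕜} {z : 𝕜} (hf : AnalyticAt 𝕜 f z) :
    AnalyticAt 𝕜 (dslope f z) z := by
  obtain ⟨p, hp⟩ := hf
  exact ⟨_, hp.has_fpower_series_dslope_fslope⟩

theorem eq_add_mul_dslope_zero {𝕜 : Type*} [RCLike 𝕜] (f : 𝕜 → 𝕜) (z : 𝕜) :
    f z = f 0 + z * dslope f 0 z := by
  have := sub_smul_dslope f 0 z
  rw [sub_zero, smul_eq_mul] at this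
  rw [this]
  ring

theorem dslope_im_eq_zero {h : ℂ → ℂ} (hh : AnalyticAt ℂ h 0)
    (hreal : ∀ᶠ x : ℝ in 𝓝 0, (h x).im = 0) : ∀ᶠ x : ℝ in 𝓝 0, (dslope h 0 x).im = 0 := by
  have h0 : (h 0).im = 0 := by simpa using hreal.self_of_nhds
  have hne : ∀ᶠ x : ℝ in 𝓝[≠] 0, (dslope h 0 x).im = 0 := by
    filter_upwards [hreal.filter_mono nhdsWithin_le_nhds, self_mem_nhdsWithin] with x hx hx0
    have h1 := congrArg Complex.im (eq_add_mul_dslope_zero h x)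
    rw [Complex.add_im, hx, h0, zero_add, Complex.im_ofReal_mul] at h1
    exact (mul_eq_zero.1 h1.symm).resolve_left hx0
  have hc : ContinuousAt (fun x : ℝ => (dslope h 0 x).im) 0 := by
    have h1 : ContinuousAt (dslope h 0) ((0 : ℝ) : ℂ) := by
      simpa using hh.dslope_self.continuousAt
    exact Complex.continuous_im.continuousAt.comp
      (ContinuousAt.comp (f := fun x : ℝ => (x : ℂ)) h1 Complex.continuous_ofReal.continuousAt)
  have h2 : (dslope h 0 ((0 : ℝ) : ℂ)).im = 0 := tendsto_nhds_unique_of_eventuallyEq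
    (hc.tendsto.mono_left (nhdsWithin_le_nhds (s := {0}ᶜ))) tendsto_const_nhds hne
  rw [← nhdsNE_sup_pure, eventually_sup]
  exact ⟨hne, h2⟩

/-- If `-h(w) / w` extends to a map of the upper half-plane to itself that is bounded away from
the origin, and `h` is real on the real axis near the origin, then its fourth derivative there is
not positive. -/
theorem iteratedDeriv_four_nonpos_of_im_nonneg {F h : ℂ → ℂ} {η : ℝ → ℝ} {C : ℝ}
    (hF : ∀ w : ℂ, 0 < w.im → DifferentiableAt ℂ F w) (hpos : ∀ w : ℂ, 0 < w.im → 0 ≤ (F w).im)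
    (hC : ∀ w : ℂ, 0 < w.im → ‖F w‖ ≤ C * (1 + ‖w‖⁻¹)) (hh : AnalyticAt ℂ h 0)
    (hη : AnalyticAt ℝ η 0) (hhη : ∀ᶠ x : ℝ in 𝓝 0, h x = η x)
    (hFh : ∀ᶠ w in 𝓝 (0 : ℂ), 0 < w.im → w * F w = -h w) : iteratedDeriv 4 η 0 ≤ 0 := by
  let h₁ := dslope h 0
  let h₂ := dslope h₁ 0
  let h₃ := dslope h₂ 0
  let h₄ := dslope h₃ 0
  have ha₁ : AnalyticAt ℂ h₁ 0 := hh.dslope_self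
  have ha₂ : AnalyticAt ℂ h₂ 0 := ha₁.dslope_self
  have ha₃ : AnalyticAt ℂ h₃ 0 := ha₂.dslope_self
  have ha₄ : AnalyticAt ℂ h₄ 0 := ha₃.dslope_self
  have hr₀ : ∀ᶠ x : ℝ in 𝓝 0, (h x).im = 0 := hhη.mono fun x hx => by rw [hx]; simp
  have hr₁ : ∀ᶠ x : ℝ in 𝓝 0, (h₁ x).im = 0 := dslope_im_eq_zero hh hr₀
  have hr₂ : ∀ᶠ x : ℝ in 𝓝 0, (h₂ x).im = 0 := dslope_im_eq_zero ha₁ hr₁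
  have hr₃ : ∀ᶠ x : ℝ in 𝓝 0, (h₃ x).im = 0 := dslope_im_eq_zero ha₂ hr₂
  have hre : ∀ {z : ℂ}, z.im = 0 → z = (z.re : ℂ) := fun {z} hz =>
    Complex.ext (by simp) (by simp [hz])
  have hc₀ := hre (by simpa using hr₀.self_of_nhds : (h 0).im = 0)
  have hc₁ := hre (by simpa using hr₁.self_of_nhds : (h₁ 0).im = 0)
  have hc₂ := hre (by simpa using hr₂.self_of_nhds : (h₂ 0).im = 0)
  have hc₃ := hre (by simpa using hr₃.self_of_nhds : (h₃ 0).im = 0)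
  have hexp : ∀ z, h z = h 0 + z * (h₁ 0 + z * (h₂ 0 + z * h₃ z)) := fun z => by
    rw [eq_add_mul_dslope_zero h z, eq_add_mul_dslope_zero (dslope h 0) z,
      eq_add_mul_dslope_zero (dslope (dslope h 0) 0) z]
  have key : (deriv h₃ 0).re ≤ 0 := by
    refine re_deriv_nonpos_of_im_nonneg (F := F) (c₀ := (h 0).re) (c₁ := (h₁ 0).re)
      (c₂ := (h₂ 0).re) hF hpos hC ha₃ hr₃ ?_
    filter_upwards [hFh] with w hw hw0
    have hne : w ≠ 0 := fun h => by simp [h] at hw0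
    have h1 := hw hw0
    rw [hexp w] at h1
    rw [← hc₀, ← hc₁, ← hc₂]
    field_simp
    linear_combination h1
  obtain ⟨a₀, a₁, a₂, a₃, G, hG, hG0, hηG⟩ := hη.exists_taylor_four
  have hcont : ContinuousAt (fun x : ℝ => (h₄ x).re) 0 := by
    have h1 : ContinuousAt h₄ ((0 : ℝ) : ℂ) := by simpa using ha₄.continuousAt
    exact Complex.continuous_re.continuousAt.comp
      (ContinuousAt.comp (f := fun x : ℝ => (x : ℂ)) h1 Complex.continuous_ofReal.continuousAt)
  have huniq := horner_four_unique (b₀ := (h 0).re) (b₁ := (h₁ 0).re) (b₂ := (h₂ 0).re)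
    (b₃ := (h₃ 0).re) hG.continuousAt hcont (by
      filter_upwards [hηG, hhη] with x h1 h2
      rw [← h1]
      have h3 := hexp x
      rw [h2, eq_add_mul_dslope_zero h₃ x, hc₀, hc₁, hc₂, hc₃] at h3
      have h4 := congrArg Complex.re h3
      simpa using h4)
  have h5 : iteratedDeriv 4 η 0 / 24 = (deriv h₃ 0).re := by
    rw [← hG0, huniq.2.2.2.2]
    simp [h₄, dslope_same]
  linarith

end TaylorCoefficients

section Pencil

open Polynomial Matrix

variable {n : ℕ}

theorem coeff_charpoly_add_smul (P Q : Matrix (Fin n) (Fin n) ℂ) (i : ℕ) :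
    ∃ c : ℂ[X], ∀ z : ℂ, (P + z • Q).charpoly.coeff i = c.eval z := by
  let M : Matrix (Fin n) (Fin n) ℂ[X] := P.map C + (X : ℂ[X]) • Q.map C
  refine ⟨M.charpoly.coeff i, fun z => ?_⟩
  have hM : P + z • Q = M.map (evalRingHom z) := by
    ext a b
    simp [M, mul_comm z]
  rw [hM, charpoly_map, coeff_map]
  rfl

theorem analyticMonicFamily_charpoly (P Q : Matrix (Fin n) (Fin n) ℂ) (z₀ : ℂ) :
    AnalyticMonicFamily (fun z : ℂ => (P + z • Q).charpoly) n z₀ where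
  monic z := charpoly_monic _
  natDegree z := by simp [charpoly_natDegree_eq_dim]
  analyticAt i := by
    obtain ⟨c, hc⟩ := coeff_charpoly_add_smul P Q i
    simp only [hc]
    exact AnalyticOnNhd.eval_polynomial c z₀ (Set.mem_univ _)

theorem charpoly_smul_eq_scaleRoots (K : Matrix (Fin n) (Fin n) ℂ) {w : ℂ} (hw : w ≠ 0) :
    (w • K).charpoly = K.charpoly.scaleRoots w := by
  refine Polynomial.funext fun x => ?_
  have hx : x = w * (w⁻¹ * x) := by field_simp
  rw [hx, scaleRoots_eval_mul, eval_charpoly, eval_charpoly, charpoly_natDegree_eq_dim]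
  rw [← det_smul]
  congr 1
  ext a b
  by_cases h : a = b <;> simp [h, mul_sub]

theorem roots_charpoly_smul (K : Matrix (Fin n) (Fin n) ℂ) {w : ℂ} (hw : w ≠ 0) :
    (w • K).charpoly.roots = K.charpoly.roots.map fun r => w * r := by
  rw [charpoly_smul_eq_scaleRoots K hw, roots_scaleRoots _ hw.isUnit]

theorem norm_root_charpoly_le (M : Matrix (Fin n) (Fin n) ℂ) {r : ℂ} (hr : M.charpoly.IsRoot r) :
    ‖r‖ ≤ ∑ i, ∑ j, ‖M i j‖ := by
  have hev : Module.End.HasEigenvalue (Matrix.toLin' M) r := by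
    rw [Module.End.hasEigenvalue_iff_mem_spectrum, spectrum_toLin']
    exact mem_spectrum_iff_isRoot_charpoly.2 hr
  obtain ⟨k, hk⟩ := eigenvalue_mem_ball hev
  rw [mem_closedBall_iff_norm] at hk
  have h1 : ‖r‖ ≤ ‖M k k‖ + ∑ j ∈ Finset.univ.erase k, ‖M k j‖ := by
    have := norm_add_le (M k k) (r - M k k)
    rw [add_sub_cancel] at this
    linarith
  rw [Finset.add_sum_erase _ (fun j => ‖M k j‖) (Finset.mem_univ k)] at h1
  exact h1.trans (Finset.single_le_sum (f := fun i => ∑ j, ‖M i j‖)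
    (fun i _ => Finset.sum_nonneg fun j _ => norm_nonneg _) (Finset.mem_univ k))

/-- A singular combination of Hermitian matrices leads to a scalar relation with real
coefficients. -/
theorem Matrix.IsHermitian.exists_form_eq_zero {A B : Matrix (Fin n) (Fin n) ℂ}
    (hA : A.IsHermitian) (hB : B.IsHermitian) {α β γ : ℂ}
    (h : (α • (1 : Matrix (Fin n) (Fin n) ℂ) + β • A + γ • B).det = 0) :
    ∃ s a b : ℝ, 0 < s ∧ |b| ≤ (∑ i, ∑ j, ‖B i j‖) * s ∧ α * s + β * a + γ * b = 0 := by
  obtain ⟨x, hx0, hx⟩ := exists_mulVec_eq_zero_iff.2 h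
  have hreal : ∀ {M : Matrix (Fin n) (Fin n) ℂ}, M.IsHermitian →
      star x ⬝ᵥ (M *ᵥ x) = (((star x ⬝ᵥ (M *ᵥ x)).re : ℝ) : ℂ) := fun {M} hM => by
    have := hM.im_star_dotProduct_mulVec_self x
    exact Complex.ext (by simp) (by simpa using this)
  have hpos : 0 < star x ⬝ᵥ x := dotProduct_star_self_pos_iff.2 hx0
  have hsum : star x ⬝ᵥ x = ((∑ i, ‖x i‖ ^ 2 : ℝ) : ℂ) := by
    simp only [dotProduct, Pi.star_apply, RCLike.star_def, Complex.conj_mul']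
    push_cast
    rfl
  refine ⟨∑ i, ‖x i‖ ^ 2, (star x ⬝ᵥ (A *ᵥ x)).re, (star x ⬝ᵥ (B *ᵥ x)).re, ?_, ?_, ?_⟩
  · rw [hsum] at hpos
    exact_mod_cast hpos
  · refine (Complex.abs_re_le_norm _).trans ?_
    have hle : ∀ i, ‖x i‖ ^ 2 ≤ ∑ i, ‖x i‖ ^ 2 := fun i =>
      Finset.single_le_sum (f := fun i => ‖x i‖ ^ 2) (fun _ _ => by positivity) (Finset.mem_univ i)
    simp only [dotProduct, mulVec]
    rw [Finset.sum_mul]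
    refine (norm_sum_le _ _).trans (Finset.sum_le_sum fun i _ => ?_)
    rw [Finset.sum_mul, Finset.mul_sum]
    refine (norm_sum_le _ _).trans ?_
    refine Finset.sum_le_sum fun j _ => ?_
    rw [norm_mul, norm_mul, Pi.star_apply, norm_star]
    nlinarith [hle i, hle j, norm_nonneg (B i j), sq_nonneg (‖x i‖ - ‖x j‖),
      mul_le_mul_of_nonneg_left (show ‖x i‖ * ‖x j‖ ≤ ∑ i, ‖x i‖ ^ 2 by
        nlinarith [hle i, hle j, sq_nonneg (‖x i‖ - ‖x j‖)]) (norm_nonneg (B i j))]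
  · rw [← hsum, ← hreal hA, ← hreal hB]
    have := congrArg (fun y => star x ⬝ᵥ y) hx
    simpa [add_mulVec, smul_mulVec, dotProduct_add, dotProduct_smul, one_mulVec] using this

variable {A B : Matrix (Fin n) (Fin n) ℂ}

/-- `A⁻¹ (z - B)`, whose eigenvalues `r` are the solutions of `det (r A + B - z) = 0`. -/
noncomputable def slopeMatrix (A B : Matrix (Fin n) (Fin n) ℂ) (z : ℂ) :
    Matrix (Fin n) (Fin n) ℂ := -(A⁻¹ * B) + z • A⁻¹

/-- `-A⁻¹ (1 + w B)`, whose eigenvalues `v` are the solutions of `det (1 + v A + w B) = 0`. -/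
noncomputable def dualMatrix (A B : Matrix (Fin n) (Fin n) ℂ) (w : ℂ) :
    Matrix (Fin n) (Fin n) ℂ := -A⁻¹ + w • -(A⁻¹ * B)

theorem dualMatrix_eq_smul {w : ℂ} (hw : w ≠ 0) :
    dualMatrix A B w = w • slopeMatrix A B (-w⁻¹) := by
  rw [slopeMatrix, smul_add, smul_smul, mul_neg, mul_inv_cancel₀ hw, neg_one_smul, dualMatrix,
    add_comm]

theorem eval_charpoly_dualMatrix (hA : IsUnit A) (v w : ℂ) :
    (dualMatrix A B w).charpoly.eval v =
      A⁻¹.det * ((1 : ℂ) • (1 : Matrix (Fin n) (Fin n) ℂ) + v • A + w • B).det := by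
  have hdet : IsUnit A.det := (isUnit_iff_isUnit_det A).1 hA
  rw [eval_charpoly, ← det_mul]
  congr 1
  simp only [dualMatrix, mul_add, Matrix.mul_smul, nonsing_inv_mul _ hdet, one_smul, mul_one,
    scalar_apply, ← smul_one_eq_diagonal, smul_neg]
  abel

theorem eval_charpoly_slopeMatrix (hA : IsUnit A) (r z : ℂ) :
    (slopeMatrix A B z).charpoly.eval r =
      A⁻¹.det * ((-z) • (1 : Matrix (Fin n) (Fin n) ℂ) + r • A + (1 : ℂ) • B).det := by
  have hdet : IsUnit A.det := (isUnit_iff_isUnit_det A).1 hA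
  rw [eval_charpoly, ← det_mul]
  congr 1
  simp only [slopeMatrix, mul_add, Matrix.mul_smul, nonsing_inv_mul _ hdet, one_smul, mul_one,
    scalar_apply, ← smul_one_eq_diagonal, neg_smul, mul_neg]
  abel

theorem det_inv_ne_zero (hA : IsUnit A) : A⁻¹.det ≠ 0 :=
  ((isUnit_iff_isUnit_det _).1 (isUnit_nonsing_inv_iff.2 hA)).ne_zero

theorem exists_form_of_isRoot_dualMatrix (hA : A.IsHermitian) (hB : B.IsHermitian)
    (hAu : IsUnit A) {v w : ℂ} (h : (dualMatrix A B w).charpoly.IsRoot v) :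
    ∃ s a b : ℝ, 0 < s ∧ |b| ≤ (∑ i, ∑ j, ‖B i j‖) * s ∧ s + v * a + w * b = 0 := by
  rw [IsRoot.def, eval_charpoly_dualMatrix hAu] at h
  simpa using hA.exists_form_eq_zero hB ((mul_eq_zero.1 h).resolve_left (det_inv_ne_zero hAu))

theorem exists_form_of_isRoot_slopeMatrix (hA : A.IsHermitian) (hB : B.IsHermitian)
    (hAu : IsUnit A) {r z : ℂ} (h : (slopeMatrix A B z).charpoly.IsRoot r) :
    ∃ s a b : ℝ, 0 < s ∧ |b| ≤ (∑ i, ∑ j, ‖B i j‖) * s ∧ -z * s + r * a + b = 0 := by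
  rw [IsRoot.def, eval_charpoly_slopeMatrix hAu] at h
  simpa using hA.exists_form_eq_zero hB ((mul_eq_zero.1 h).resolve_left (det_inv_ne_zero hAu))

theorem im_ne_zero_of_isRoot_slopeMatrix (hA : A.IsHermitian) (hB : B.IsHermitian)
    (hAu : IsUnit A) {r z : ℂ} (hz : 0 < z.im) (h : (slopeMatrix A B z).charpoly.IsRoot r) :
    r.im ≠ 0 := by
  obtain ⟨s, a, b, hs, -, h⟩ := exists_form_of_isRoot_slopeMatrix hA hB hAu h
  intro h0
  have := congrArg Complex.im h
  simp [h0] at this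
  rcases this with h | h
  · exact hz.ne' h
  · exact hs.ne' h

theorem sign_re_eq_neg_sign_im (hA : A.IsHermitian) (hB : B.IsHermitian)
    (hAu : IsUnit A) {r w : ℂ} (hw : 0 < w.im) (hwB : ‖w‖ * (∑ i, ∑ j, ‖B i j‖) < 1)
    (h : (slopeMatrix A B (-w⁻¹)).charpoly.IsRoot r) :
    SignType.sign (w * r).re = -SignType.sign r.im := by
  obtain ⟨s, a, b, hs, hb, h⟩ := exists_form_of_isRoot_slopeMatrix hA hB hAu h
  have hw0 : w ≠ 0 := fun h => by simp [h] at hw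
  have h1 : r * a = -w⁻¹ * s - b := by linear_combination h
  have h2 : w * r * a = -s - w * b := by
    rw [mul_assoc, h1]
    field_simp
  have him : 0 < r.im * a := by
    have := congrArg Complex.im h1
    simp only [Complex.im_mul_ofReal, Complex.sub_im, Complex.ofReal_im, Complex.neg_im,
      Complex.inv_im, sub_zero] at this
    rw [this]
    have : 0 < Complex.normSq w := Complex.normSq_pos.2 hw0
    rw [neg_div, neg_neg]
    positivity
  have hre : (w * r).re * a < 0 := by
    have := congrArg Complex.re h2
    rw [Complex.re_mul_ofReal, Complex.sub_re, Complex.re_mul_ofReal, Complex.neg_re,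
      Complex.ofReal_re] at this
    rw [this]
    have h3 : |w.re * b| < s := by
      rw [abs_mul]
      calc |w.re| * |b| ≤ ‖w‖ * ((∑ i, ∑ j, ‖B i j‖) * s) :=
            mul_le_mul (Complex.abs_re_le_norm w) hb (abs_nonneg _) (norm_nonneg _)
        _ = ‖w‖ * (∑ i, ∑ j, ‖B i j‖) * s := by ring
        _ < 1 * s := mul_lt_mul_of_pos_right hwB hs
        _ = s := one_mul s
    have := neg_abs_le (w.re * b)
    linarith
  rcases lt_trichotomy a 0 with ha | ha | ha
  · rw [sign_pos (pos_of_mul_neg_left hre ha.le), sign_neg (neg_of_mul_pos_left him ha.le)]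
    rfl
  · simp [ha] at him
  · rw [sign_neg (neg_of_mul_neg_left hre ha.le), sign_pos (pos_of_mul_pos_left him ha.le)]

/-- The signed root sum of `A⁻¹ (z - B)` at `z = -1/w`. -/
noncomputable def pickFunction (A B : Matrix (Fin n) (Fin n) ℂ) (w : ℂ) : ℂ :=
  signedRootSum 1 (slopeMatrix A B (-w⁻¹)).charpoly

theorem neg_inv_im_pos {w : ℂ} (hw : 0 < w.im) : 0 < (-w⁻¹).im := by
  have hw0 : w ≠ 0 := fun h => by simp [h] at hw
  have : 0 < Complex.normSq w := Complex.normSq_pos.2 hw0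
  rw [Complex.neg_im, Complex.inv_im, neg_div, neg_neg]
  positivity

theorem differentiableAt_pickFunction (hA : A.IsHermitian) (hB : B.IsHermitian) (hAu : IsUnit A)
    {w : ℂ} (hw : 0 < w.im) : DifferentiableAt ℂ (pickFunction A B) w := by
  have hw0 : w ≠ 0 := fun h => by simp [h] at hw
  have h1 : AnalyticAt ℂ (fun z => signedRootSum 1 (slopeMatrix A B z).charpoly) (-w⁻¹) :=
    (analyticMonicFamily_charpoly _ _ _).analyticAt_signedRootSum 1 fun z hz => by
      rw [one_mul]
      exact im_ne_zero_of_isRoot_slopeMatrix hA hB hAu (neg_inv_im_pos hw) hz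
  exact DifferentiableAt.comp (g := fun z => signedRootSum 1 (slopeMatrix A B z).charpoly) w
    h1.differentiableAt (differentiableAt_inv hw0).neg

theorem pickFunction_im_nonneg (A B : Matrix (Fin n) (Fin n) ℂ) (w : ℂ) :
    0 ≤ (pickFunction A B w).im := by
  rw [pickFunction, signedRootSum, ← Complex.coe_imAddGroupHom, map_multiset_sum]
  refine Multiset.sum_nonneg fun x hx => ?_
  simp only [Multiset.map_map, Multiset.mem_map, Function.comp] at hx
  obtain ⟨z, -, rfl⟩ := hx
  rw [Complex.coe_imAddGroupHom, Complex.im_ofReal_mul, one_mul, sign_mul_self]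
  exact abs_nonneg _

theorem norm_pickFunction_le (A B : Matrix (Fin n) (Fin n) ℂ) :
    ∃ C : ℝ, ∀ w, ‖pickFunction A B w‖ ≤ C * (1 + ‖w‖⁻¹) := by
  let S : ℝ := ∑ i, ∑ j, (‖(A⁻¹ * B) i j‖ + ‖A⁻¹ i j‖)
  refine ⟨n * S, fun w => ?_⟩
  have hS : ∀ r, (slopeMatrix A B (-w⁻¹)).charpoly.IsRoot r → ‖r‖ ≤ S * (1 + ‖w‖⁻¹) := by
    intro r hr
    refine (norm_root_charpoly_le _ hr).trans ?_
    simp only [S, Finset.sum_mul]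
    refine Finset.sum_le_sum fun i _ => Finset.sum_le_sum fun j _ => ?_
    have h1 : ‖slopeMatrix A B (-w⁻¹) i j‖ ≤ ‖(A⁻¹ * B) i j‖ + ‖w‖⁻¹ * ‖A⁻¹ i j‖ := by
      simp only [slopeMatrix, Matrix.add_apply, Matrix.neg_apply, Matrix.smul_apply, smul_eq_mul]
      refine (norm_add_le _ _).trans ?_
      rw [norm_neg, norm_mul, norm_neg, norm_inv]
    refine h1.trans ?_
    have := norm_nonneg ((A⁻¹ * B) i j)
    have := norm_nonneg (A⁻¹ i j)
    have : 0 ≤ ‖w‖⁻¹ := by positivity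
    nlinarith [mul_nonneg this (norm_nonneg ((A⁻¹ * B) i j))]
  rw [pickFunction, signedRootSum]
  have hcard : (slopeMatrix A B (-w⁻¹)).charpoly.roots.card = n := by
    rw [← (IsAlgClosed.splits _).natDegree_eq_card_roots, charpoly_natDegree_eq_dim,
      Fintype.card_fin]
  refine (norm_multiset_sum_le _).trans ?_
  rw [Multiset.map_map]
  refine (Multiset.sum_le_card_nsmul _ (S * (1 + ‖w‖⁻¹)) fun x hx => ?_).trans_eq ?_
  · obtain ⟨r, hr, rfl⟩ := Multiset.mem_map.1 hx
    refine le_trans ?_ (hS r (mem_roots'.1 hr).2)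
    rw [Function.comp, norm_mul, Complex.norm_real]
    refine mul_le_of_le_one_left (norm_nonneg _) ?_
    rcases SignType.sign (1 * r).im <;> simp
  · rw [Multiset.card_map, hcard, nsmul_eq_mul, mul_assoc]

theorem mul_pickFunction (hA : A.IsHermitian) (hB : B.IsHermitian) (hAu : IsUnit A) {w : ℂ}
    (hw : 0 < w.im) (hwB : ‖w‖ * (∑ i, ∑ j, ‖B i j‖) < 1) :
    w * pickFunction A B w = -signedRootSum Complex.I (dualMatrix A B w).charpoly := by
  have hw0 : w ≠ 0 := fun h => by simp [h] at hw
  rw [dualMatrix_eq_smul hw0, signedRootSum, roots_charpoly_smul _ hw0, Multiset.map_map,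
    ← Multiset.sum_map_neg, pickFunction, signedRootSum, ← Multiset.sum_map_mul_left]
  congr 1
  refine Multiset.map_congr rfl fun r hr => ?_
  have := sign_re_eq_neg_sign_im hA hB hAu hw hwB (mem_roots'.1 hr).2
  rw [Function.comp, Complex.I_mul_im, this, one_mul]
  rcases SignType.sign r.im <;> simp

theorem analyticAt_signedRootSum_dualMatrix (hA : A.IsHermitian) (hB : B.IsHermitian)
    (hAu : IsUnit A) :
    AnalyticAt ℂ (fun w => signedRootSum Complex.I (dualMatrix A B w).charpoly) 0 := by
  refine (analyticMonicFamily_charpoly _ _ _).analyticAt_signedRootSum _ fun v hv => ?_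
  obtain ⟨s, a, b, hs, -, h⟩ := exists_form_of_isRoot_dualMatrix hA hB hAu hv
  rw [Complex.I_mul_im]
  intro h0
  have := congrArg Complex.re h
  simp [h0] at this
  exact hs.ne' this

/-- The fourth derivative of the sum of the absolute values of the solutions `v` of
`det (1 + v A + w B) = 0` is not positive. -/
theorem iteratedDeriv_four_signedRootSum_nonpos (hA : A.IsHermitian) (hB : B.IsHermitian)
    (hAu : IsUnit A) {η : ℝ → ℝ} (hη : AnalyticAt ℝ η 0)
    (h : ∀ᶠ x : ℝ in 𝓝 0, signedRootSum Complex.I (dualMatrix A B x).charpoly = η x) :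
    iteratedDeriv 4 η 0 ≤ 0 := by
  obtain ⟨C, hC⟩ := norm_pickFunction_le A B
  refine iteratedDeriv_four_nonpos_of_im_nonneg (F := pickFunction A B) (C := C)
    (fun w hw => differentiableAt_pickFunction hA hB hAu hw)
    (fun w _ => pickFunction_im_nonneg A B w) (fun w _ => hC w)
    (analyticAt_signedRootSum_dualMatrix hA hB hAu) hη h ?_
  have hc : ContinuousAt (fun w : ℂ => ‖w‖ * (∑ i, ∑ j, ‖B i j‖)) 0 := by fun_prop
  filter_upwards [hc.eventually_lt continuousAt_const (by simp : ‖(0 : ℂ)‖ * _ < (1 : ℝ))]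
    with w hwB hw
  exact mul_pickFunction hA hB hAu hw hwB

end Pencil

section Eigenvalues

open Polynomial Matrix

variable {n : ℕ}

theorem roots_prod_X_sub_C_fun {ι K : Type*} [Fintype ι] [Field K] (f : ι → K) :
    (∏ i, (X - C (f i))).roots = Finset.univ.val.map f := by
  have := roots_multiset_prod_X_sub_C (Finset.univ.val.map f)
  rwa [Multiset.map_map] at this

theorem isHermitian_add_smul {A B : Matrix (Fin n) (Fin n) ℂ} (hA : A.IsHermitian)
    (hB : B.IsHermitian) (t : ℝ) : (A + t • B).IsHermitian := by
  rw [IsHermitian, conjTranspose_add, conjTranspose_smul, hA.eq, hB.eq, star_trivial]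

theorem traceAbsCube_eq_sum_roots {M : Matrix (Fin n) (Fin n) ℂ} (hM : M.IsHermitian) :
    traceAbsCube M = (M.charpoly.roots.map fun z => ‖z‖ ^ 3).sum := by
  have hsa : IsSelfAdjoint M := hM
  have h1 : CFC.abs M ^ 3 = cfc (fun x : ℝ => ‖x‖ ^ 3) M := by
    rw [CFC.abs_eq_cfc_norm M, cfc_pow (fun x : ℝ => ‖x‖) 3 M]
  have h2 := hM.charpoly_cfc_eq fun x : ℝ => ‖x‖ ^ 3
  rw [traceAbsCube, h1, trace_eq_sum_roots_charpoly, h2, hM.roots_charpoly_eq_eigenvalues,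
    roots_prod_X_sub_C_fun, Multiset.map_map]
  change (∑ i, ((‖hM.eigenvalues i‖ ^ 3 : ℝ) : ℂ)).re = ∑ i, ‖(hM.eigenvalues i : ℂ)‖ ^ 3
  rw [Complex.re_sum]
  exact Finset.sum_congr rfl fun i _ => by rw [Complex.ofReal_re, Complex.norm_real]

theorem exists_analytic_eigenvalues {A B : Matrix (Fin n) (Fin n) ℂ} (hA : A.IsHermitian)
    (hB : B.IsHermitian) (t₀ : ℝ) :
    ∃ μ : Fin n → ℝ → ℝ, (∀ j, AnalyticAt ℝ (μ j) t₀) ∧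
      ∀ᶠ t : ℝ in 𝓝 t₀, (A + t • B).charpoly = ∏ j, (X - C (μ j t : ℂ)) := by
  have hH : ∀ t : ℝ, (A + t • B).IsHermitian := isHermitian_add_smul hA hB
  let p : ℝ → ℝ[X] := fun t => ∏ i, (X - C ((hH t).eigenvalues i))
  have hpc : ∀ t, (p t).map Complex.ofRealHom = (A + t • B).charpoly := fun t => by
    rw [(hH t).charpoly_eq]
    simp [p, Polynomial.map_prod]
  have hm : ∀ t, (p t).Monic := fun t => monic_prod_X_sub_C _ _
  have hd : ∀ t, (p t).natDegree = n := fun t => by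
    simp [p]
  have hp : AnalyticMonicFamily p n t₀ := by
    refine ⟨hm, hd, fun i => ?_⟩
    obtain ⟨c, hc⟩ := coeff_charpoly_add_smul A B i
    have h1 : (fun t => (p t).coeff i) = fun t : ℝ => (c.eval (t : ℂ)).re := by
      funext t
      rw [← hc, Complex.coe_smul, ← hpc, coeff_map]
      simp
    rw [h1]
    have h2 : AnalyticAt ℂ (fun z : ℂ => c.eval z) (t₀ : ℂ) :=
      AnalyticOnNhd.eval_polynomial c _ (Set.mem_univ _)
    have h3 : AnalyticAt ℝ (fun t : ℝ => c.eval (t : ℂ)) t₀ :=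
      AnalyticAt.comp (g := fun z : ℂ => c.eval z) (f := fun t : ℝ => (t : ℂ))
        (h2.restrictScalars (𝕜 := ℝ))
        (Complex.ofRealCLM.analyticAt t₀)
    exact (Complex.reCLM.analyticAt _).comp h3
  obtain ⟨L, hLa, hL⟩ := hp.exists_analytic_roots (Eventually.of_forall fun t =>
    Splits.prod fun i _ => Splits.X_sub_C _)
  have hlen : L.length = n := by
    rw [← hd t₀, hL.self_of_nhds]
    have := natDegree_multiset_prod_X_sub_C_eq_card ((L.map fun f => f t₀ : List ℝ) : Multiset ℝ)
    simpa [Function.comp_def] using this.symm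
  subst hlen
  refine ⟨fun j => L.get j, fun j => hLa _ (L.get_mem j), ?_⟩
  filter_upwards [hL] with t ht
  rw [← hpc, ht, Polynomial.map_list_prod, List.map_map, ← List.prod_ofFn]
  congr 1
  refine List.ext_get (by simp) fun i h1 h2 => ?_
  simp

theorem pencilTrace_eq_sum {A B : Matrix (Fin n) (Fin n) ℂ} (hA : A.IsHermitian)
    (hB : B.IsHermitian) {t : ℝ} {μ : Fin n → ℝ}
    (h : (A + t • B).charpoly = ∏ j, (X - C (μ j : ℂ))) :
    pencilTrace A B t = ∑ j, |μ j| ^ 3 := by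
  rw [pencilTrace, traceAbsCube_eq_sum_roots (isHermitian_add_smul hA hB t), h,
    roots_prod_X_sub_C_fun, Multiset.map_map]
  change ∑ i, ‖(μ i : ℂ)‖ ^ 3 = ∑ i, |μ i| ^ 3
  exact Finset.sum_congr rfl fun i _ => by rw [Complex.norm_real, Real.norm_eq_abs]

end Eigenvalues

section Jet

/-- `f` has the Taylor expansion `a₀ + a₁ x + a₂ x² + a₃ x³ + a₄ x⁴ + o(x⁴)` at the origin. -/
def HasJet (f : ℝ → ℝ) (a₀ a₁ a₂ a₃ a₄ : ℝ) : Prop :=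
  ∃ G : ℝ → ℝ, ContinuousAt G 0 ∧ G 0 = a₄ ∧
    ∀ᶠ x in 𝓝 (0 : ℝ), f x = a₀ + x * (a₁ + x * (a₂ + x * (a₃ + x * G x)))

variable {f g : ℝ → ℝ} {a₀ a₁ a₂ a₃ a₄ b₀ b₁ b₂ b₃ b₄ : ℝ}

theorem HasJet.add (hf : HasJet f a₀ a₁ a₂ a₃ a₄) (hg : HasJet g b₀ b₁ b₂ b₃ b₄) :
    HasJet (fun x => f x + g x) (a₀ + b₀) (a₁ + b₁) (a₂ + b₂) (a₃ + b₃) (a₄ + b₄) := by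
  obtain ⟨G, hG, hG0, hG1⟩ := hf
  obtain ⟨H, hH, hH0, hH1⟩ := hg
  refine ⟨fun x => G x + H x, hG.add hH, by simp [hG0, hH0], ?_⟩
  filter_upwards [hG1, hH1] with x h1 h2
  rw [h1, h2]
  ring

theorem HasJet.mul (hf : HasJet f a₀ a₁ a₂ a₃ a₄) (hg : HasJet g b₀ b₁ b₂ b₃ b₄) :
    HasJet (fun x => f x * g x) (a₀ * b₀) (a₀ * b₁ + a₁ * b₀) (a₀ * b₂ + a₁ * b₁ + a₂ * b₀)
      (a₀ * b₃ + a₁ * b₂ + a₂ * b₁ + a₃ * b₀)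
      (a₀ * b₄ + a₁ * b₃ + a₂ * b₂ + a₃ * b₁ + a₄ * b₀) := by
  obtain ⟨G, hG, hG0, hG1⟩ := hf
  obtain ⟨H, hH, hH0, hH1⟩ := hg
  refine ⟨fun x => (a₀ * H x + a₁ * b₃ + a₂ * b₂ + a₃ * b₁ + G x * b₀) +
    x * (a₁ * H x + a₂ * b₃ + a₃ * b₂ + G x * b₁) + x ^ 2 * (a₂ * H x + a₃ * b₃ + G x * b₂) +
    x ^ 3 * (a₃ * H x + G x * b₃) + x ^ 4 * (G x * H x), by fun_prop, by simp [hG0, hH0], ?_⟩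
  filter_upwards [hG1, hH1] with x h1 h2
  rw [h1, h2]
  ring

theorem hasJet_const (c : ℝ) : HasJet (fun _ => c) c 0 0 0 0 :=
  ⟨fun _ => 0, continuousAt_const, rfl, Eventually.of_forall fun x => by simp⟩

theorem hasJet_id : HasJet (fun x => x) 0 1 0 0 0 :=
  ⟨fun _ => 0, continuousAt_const, rfl, Eventually.of_forall fun x => by simp⟩

theorem hasJet_pow_four_mul {G : ℝ → ℝ} (hG : ContinuousAt G 0) :
    HasJet (fun x => x ^ 4 * G x) 0 0 0 0 (G 0) :=
  ⟨G, hG, rfl, Eventually.of_forall fun x => by ring⟩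

theorem HasJet.congr (hf : HasJet f a₀ a₁ a₂ a₃ a₄) (h : f =ᶠ[𝓝 0] g) :
    HasJet g a₀ a₁ a₂ a₃ a₄ := by
  obtain ⟨G, hG, hG0, hG1⟩ := hf
  refine ⟨G, hG, hG0, ?_⟩
  filter_upwards [hG1, h] with x h1 h2
  rw [← h2, h1]

theorem HasJet.unique (hf : HasJet f a₀ a₁ a₂ a₃ a₄) (hg : HasJet f b₀ b₁ b₂ b₃ b₄) :
    a₀ = b₀ ∧ a₁ = b₁ ∧ a₂ = b₂ ∧ a₃ = b₃ ∧ a₄ = b₄ := by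
  obtain ⟨G, hG, rfl, hG1⟩ := hf
  obtain ⟨H, hH, rfl, hH1⟩ := hg
  exact horner_four_unique hG hH (by
    filter_upwards [hG1, hH1] with x h1 h2
    rw [← h1, ← h2])

theorem AnalyticAt.exists_hasJet (hf : AnalyticAt ℝ f 0) :
    ∃ a₀ a₁ a₂ a₃, HasJet f a₀ a₁ a₂ a₃ (iteratedDeriv 4 f 0 / 24) := by
  obtain ⟨a₀, a₁, a₂, a₃, G, hG, hG0, h⟩ := hf.exists_taylor_four
  exact ⟨a₀, a₁, a₂, a₃, G, hG.continuousAt, hG0, h⟩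

theorem lagrange_four_coeff {m₀ m₁ m₂ m₃ m₄ v₀ v₁ v₂ v₃ v₄ : ℝ} (hm : m₀ ≠ 0)
    (r0 : v₀ * m₀ ^ 4 = -m₀ ^ 3) (r1 : v₀ * (4 * m₀ ^ 3 * m₁) - v₁ * m₀ ^ 3 = -(3 * m₀ ^ 2 * m₁))
    (r2 : v₀ * (4 * m₀ ^ 3 * m₂ + 6 * m₀ ^ 2 * m₁ ^ 2) - v₁ * (3 * m₀ ^ 2 * m₁) + v₂ * m₀ ^ 2 =
      -(3 * m₀ ^ 2 * m₂ + 3 * m₀ * m₁ ^ 2))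
    (r3 : v₀ * (4 * m₀ ^ 3 * m₃ + 12 * m₀ ^ 2 * m₁ * m₂ + 4 * m₀ * m₁ ^ 3) -
      v₁ * (3 * m₀ ^ 2 * m₂ + 3 * m₀ * m₁ ^ 2) + v₂ * (2 * m₀ * m₁) - v₃ * m₀ =
      -(3 * m₀ ^ 2 * m₃ + 6 * m₀ * m₁ * m₂ + m₁ ^ 3))
    (r4 : v₀ * (4 * m₀ ^ 3 * m₄ + 12 * m₀ ^ 2 * m₁ * m₃ + 6 * m₀ ^ 2 * m₂ ^ 2 +
      12 * m₀ * m₁ ^ 2 * m₂ + m₁ ^ 4) - v₁ * (3 * m₀ ^ 2 * m₃ + 6 * m₀ * m₁ * m₂ + m₁ ^ 3) +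
      v₂ * (2 * m₀ * m₂ + m₁ ^ 2) - v₃ * m₁ + v₄ =
      -(3 * m₀ ^ 2 * m₄ + 6 * m₀ * m₁ * m₃ + 3 * m₀ * m₂ ^ 2 + 3 * m₁ ^ 2 * m₂)) :
    3 * v₄ = 3 * m₀ ^ 2 * m₄ + 6 * m₀ * m₁ * m₃ + 3 * m₀ * m₂ ^ 2 + 3 * m₁ ^ 2 * m₂ := by
  have s0 : v₀ * m₀ = -1 :=
    mul_left_cancel₀ (pow_ne_zero 3 hm) (by linear_combination r0)
  have s1 : v₁ * m₀ = -m₁ :=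
    mul_left_cancel₀ (pow_ne_zero 2 hm)
      (by linear_combination -r1 + 4 * m₀ ^ 2 * m₁ * s0)
  have s2 : v₂ = m₂ :=
    mul_left_cancel₀ (pow_ne_zero 2 hm) (by
      linear_combination r2 - (4 * m₀ ^ 2 * m₂ + 6 * m₀ * m₁ ^ 2) * s0 + 3 * m₀ * m₁ * s1)
  have s3 : v₃ = -(m₀ * m₃ + m₁ * m₂) :=
    mul_left_cancel₀ hm (by
      linear_combination -r3 + (4 * m₀ ^ 2 * m₃ + 12 * m₀ * m₁ * m₂ + 4 * m₁ ^ 3) * s0 -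
        (3 * m₀ * m₂ + 3 * m₁ ^ 2) * s1 + 2 * m₀ * m₁ * s2)
  have s01 : v₀ * m₁ = v₁ :=
    mul_left_cancel₀ hm (by linear_combination m₁ * s0 - s1)
  linear_combination 3 * r4 - 3 * (4 * m₀ ^ 2 * m₄ + 12 * m₀ * m₁ * m₃ + 6 * m₀ * m₂ ^ 2 +
    12 * m₁ ^ 2 * m₂) * s0 + 3 * (3 * m₀ * m₃ + 6 * m₁ * m₂) * s1 - 3 * m₁ ^ 3 * s01 -
    3 * (2 * m₀ * m₂ + m₁ ^ 2) * s2 + 3 * m₁ * s3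

/-- Lagrange inversion up to order four: if `v (-τ / μ τ) = -1 / μ τ` then
`3 [w⁴] v = [τ⁴] μ³`. -/
theorem lagrange_four {μ v G : ℝ → ℝ} {m₀ m₁ m₂ m₃ m₄ v₀ v₁ v₂ v₃ : ℝ} (hm : m₀ ≠ 0)
    (hμ : HasJet μ m₀ m₁ m₂ m₃ m₄) (hμc : ContinuousAt μ 0) (hG : ContinuousAt G 0)
    (hv : ∀ᶠ w in 𝓝 (0 : ℝ), v w = v₀ + w * (v₁ + w * (v₂ + w * (v₃ + w * G w))))
    (h : ∀ᶠ τ in 𝓝 (0 : ℝ), v (-τ / μ τ) = -1 / μ τ) :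
    ∃ q₀ q₁ q₂ q₃, HasJet (fun τ => μ τ ^ 3) q₀ q₁ q₂ q₃ (3 * G 0) := by
  have hμ0 : μ 0 = m₀ := by
    obtain ⟨K, -, -, hK⟩ := hμ
    simpa using hK.self_of_nhds
  have hne : ∀ᶠ τ in 𝓝 (0 : ℝ), μ τ ≠ 0 := hμc.eventually_ne (hμ0 ▸ hm)
  have hφ : ContinuousAt (fun τ => -τ / μ τ) 0 :=
    continuousAt_id.neg.div hμc (hμ0 ▸ hm)
  have hφ0 : Tendsto (fun τ => -τ / μ τ) (𝓝 0) (𝓝 0) := by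
    simpa using hφ.tendsto
  have hGφ : ContinuousAt (fun τ => G (-τ / μ τ)) 0 :=
    ContinuousAt.comp (f := fun τ => -τ / μ τ) (by simpa using hG) hφ
  have j2 := hμ.mul hμ
  have j3 := j2.mul hμ
  have j4 := j3.mul hμ
  have t2 := hasJet_id.mul hasJet_id
  have t3 := t2.mul hasJet_id
  have e0 := (hasJet_const v₀).mul j4
  have e1 := (hasJet_const (-v₁)).mul (hasJet_id.mul j3)
  have e2 := (hasJet_const v₂).mul (t2.mul j2)
  have e3 := (hasJet_const (-v₃)).mul (t3.mul hμ)
  have e4 := hasJet_pow_four_mul hGφ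
  have esum := (((e0.add e1).add e2).add e3).add e4
  have hright := (hasJet_const (-1)).mul j3
  have heq : (fun τ => v₀ * (μ τ * μ τ * μ τ * μ τ) + -v₁ * (τ * (μ τ * μ τ * μ τ)) +
      v₂ * (τ * τ * (μ τ * μ τ)) + -v₃ * (τ * τ * τ * μ τ) + τ ^ 4 * G (-τ / μ τ)) =ᶠ[𝓝 0]
      fun τ => -1 * (μ τ * μ τ * μ τ) := by
    filter_upwards [hne, h, hφ0.eventually hv] with τ h1 h2 h3
    obtain ⟨y, hy⟩ : ∃ y, y = -τ / μ τ := ⟨_, rfl⟩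
    have hτ : τ = -(y * μ τ) := by
      rw [hy]
      field_simp
    rw [h2, ← hy, div_eq_iff h1] at h3
    rw [← hy]
    generalize μ τ = m at *
    subst hτ
    linear_combination -m ^ 3 * h3
  obtain ⟨r0, r1, r2, r3, r4⟩ := (esum.congr heq).unique hright
  simp only [neg_zero, zero_div] at r4
  have key := lagrange_four_coeff (m₀ := m₀) (m₁ := m₁) (m₂ := m₂) (m₃ := m₃) (m₄ := m₄)
    (v₀ := v₀) (v₁ := v₁) (v₂ := v₂) (v₃ := v₃) (v₄ := G 0) hm (by linear_combination r0)
    (by linear_combination r1) (by linear_combination r2) (by linear_combination r3)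
    (by linear_combination r4)
  have j3' := j3.congr (g := fun τ => μ τ ^ 3) (Eventually.of_forall fun τ => by ring)
  obtain ⟨q, hq, hj⟩ : ∃ q, q = 3 * G 0 ∧
      ∃ q₀ q₁ q₂ q₃, HasJet (fun τ => μ τ ^ 3) q₀ q₁ q₂ q₃ q :=
    ⟨_, by rw [key]; ring, _, _, _, _, j3'⟩
  exact hq ▸ hj

end Jet

section DualBranch

theorem exists_dual_branch {μ : ℝ → ℝ} (hμ : AnalyticAt ℝ μ 0) (h0 : μ 0 ≠ 0) :
    ∃ v : ℝ → ℝ, AnalyticAt ℝ v 0 ∧ v 0 = -1 / μ 0 ∧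
      (∀ᶠ w in 𝓝 (0 : ℝ), 1 + v w * μ (w / v w) = 0) ∧
      iteratedDeriv 4 (fun t => μ t ^ 3) 0 = 3 * iteratedDeriv 4 v 0 := by
  set φ : ℝ → ℝ := fun τ => -τ / μ τ with hφdef
  have hφ : AnalyticAt ℝ φ 0 := analyticAt_id.neg.div hμ h0
  have hφ0 : φ 0 = 0 := by simp [hφdef]
  have hφ' : deriv φ 0 ≠ 0 := by
    have h1 : HasDerivAt φ ((-1 * μ 0 - -0 * deriv μ 0) / μ 0 ^ 2) 0 :=
      (hasDerivAt_id (0 : ℝ)).neg.div hμ.differentiableAt.hasDerivAt h0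
    rw [h1.deriv]
    simp [h0]
  have hψ := hφ.analyticAt_localInverse hφ'
  have hl := hφ.hasStrictDerivAt.eventually_left_inverse hφ'
  have hr := hφ.hasStrictDerivAt.eventually_right_inverse hφ'
  generalize hφ.hasStrictDerivAt.localInverse _ _ _ hφ' = ψ at hψ hl hr
  rw [hφ0] at hψ hr
  have hψ0 : ψ 0 = 0 := by simpa [hφ0] using hl.self_of_nhds
  have hμψ : AnalyticAt ℝ (fun w => μ (ψ w)) 0 :=
    AnalyticAt.comp (g := μ) (by rwa [hψ0]) hψ
  have hv : AnalyticAt ℝ (fun w => -1 / μ (ψ w)) 0 :=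
    analyticAt_const.div hμψ (by rwa [hψ0])
  have hne : ∀ᶠ w in 𝓝 (0 : ℝ), μ (ψ w) ≠ 0 := hμψ.continuousAt.eventually_ne (by rwa [hψ0])
  refine ⟨fun w => -1 / μ (ψ w), hv, by simp [hψ0], ?_, ?_⟩
  · filter_upwards [hne, hr] with w h1 h2
    have h3 : w / (-1 / μ (ψ w)) = ψ w := by
      have h4 : w = -ψ w / μ (ψ w) := h2.symm
      generalize ψ w = s at *
      rw [h4]
      field_simp
    rw [h3]
    field_simp
    ring
  · obtain ⟨m₀, m₁, m₂, m₃, hm⟩ := hμ.exists_hasJet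
    obtain ⟨v₀, v₁, v₂, v₃, G, hG, hG0, hvG⟩ := hv.exists_taylor_four
    have hm0 : m₀ ≠ 0 := by
      obtain ⟨K, -, -, hK⟩ := hm
      have := hK.self_of_nhds
      rw [zero_mul, add_zero] at this
      rwa [← this]
    obtain ⟨q₀, q₁, q₂, q₃, hq⟩ := lagrange_four hm0 hm hμ.continuousAt hG.continuousAt hvG
      (by filter_upwards [hl] with τ hτ
          change -1 / μ (ψ (φ τ)) = _
          rw [hτ])
    have hμ3 : AnalyticAt ℝ (fun t => μ t ^ 3) 0 := hμ.pow 3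
    obtain ⟨p₀, p₁, p₂, p₃, hp⟩ := hμ3.exists_hasJet
    have := (hp.unique hq).2.2.2.2
    rw [hG0] at this
    linarith

end DualBranch

section Matching

open Polynomial Matrix

theorem card_le_rootMultiplicity_of_eval_eq_prod {ι : Type*} [Fintype ι] {p : ℂ[X]} (hp : p ≠ 0)
    {x₀ : ℝ} {c : ℂ} {F : ι → ℝ → ℂ} (hF : ∀ i, DifferentiableAt ℝ (F i) x₀)
    (h : ∀ᶠ x : ℝ in 𝓝 x₀, p.eval (x : ℂ) = c * ∏ i, F i x) (J : Finset ι)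
    (hJ : ∀ i ∈ J, F i x₀ = 0) : J.card ≤ p.rootMultiplicity (x₀ : ℂ) := by
  classical
  by_contra! hlt
  obtain ⟨q, hq, hdvd⟩ := exists_eq_pow_rootMultiplicity_mul_and_not_dvd p hp (x₀ : ℂ)
  set k := p.rootMultiplicity (x₀ : ℂ)
  have hq0 : q.eval (x₀ : ℂ) ≠ 0 := fun h0 => hdvd (dvd_iff_isRoot.2 h0)
  set H : ℝ → ℂ := fun x =>
    c * ((∏ i ∈ J, dslope (F i) x₀ x) * ∏ i ∈ Finset.univ \ J, F i x) with hH
  have hHc : ContinuousAt H x₀ := by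
    refine continuousAt_const.mul (ContinuousAt.mul ?_ ?_)
    · exact tendsto_finsetProd _ fun i _ => continuousAt_dslope_same.2 (hF i)
    · exact tendsto_finsetProd _ fun i _ => (hF i).continuousAt
  have hofReal : ContinuousAt (fun x : ℝ => (x : ℂ)) x₀ := Complex.continuous_ofReal.continuousAt
  have hqc : ContinuousAt (fun x : ℝ => q.eval (x : ℂ)) x₀ :=
    ContinuousAt.comp (g := fun z : ℂ => q.eval z) q.continuous.continuousAt hofReal
  have hR : ContinuousAt (fun x : ℝ => ((x : ℂ) - x₀) ^ (J.card - k) * H x) x₀ :=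
    ((hofReal.sub continuousAt_const).pow _).mul hHc
  have heq : ∀ᶠ x : ℝ in 𝓝[≠] x₀, q.eval (x : ℂ) = ((x : ℂ) - x₀) ^ (J.card - k) * H x := by
    filter_upwards [h.filter_mono nhdsWithin_le_nhds, self_mem_nhdsWithin] with x hx hne
    have hne' : (x : ℂ) - x₀ ≠ 0 := by
      rw [← Complex.ofReal_sub]
      exact_mod_cast sub_ne_zero.2 hne
    refine mul_left_cancel₀ (pow_ne_zero k hne') ?_
    have h1 : p.eval (x : ℂ) = ((x : ℂ) - x₀) ^ k * q.eval (x : ℂ) := by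
      conv_lhs => rw [hq]
      simp
    have h2 : ∏ i, F i x =
        ((x : ℂ) - x₀) ^ J.card * ((∏ i ∈ J, dslope (F i) x₀ x) * ∏ i ∈ Finset.univ \ J, F i x) := by
      rw [← Finset.prod_sdiff (Finset.subset_univ J), mul_comm, ← mul_assoc,
        ← Finset.prod_const, ← Finset.prod_mul_distrib]
      congr 1
      refine Finset.prod_congr rfl fun i hi => ?_
      have := sub_smul_dslope (F i) x₀ x
      rw [hJ i hi, sub_zero] at this
      rw [← this, Complex.real_smul, Complex.ofReal_sub]
    rw [← h1, hx, h2, ← mul_assoc (_ ^ k), ← pow_add, Nat.add_sub_cancel' hlt.le]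
    simp only [hH]
    ring
  have hlim := tendsto_nhds_unique_of_eventuallyEq
    (hqc.tendsto.mono_left (nhdsWithin_le_nhds (s := {x₀}ᶜ)))
    (hR.tendsto.mono_left nhdsWithin_le_nhds) heq
  refine hq0 (hlim.trans ?_)
  rw [sub_self, zero_pow (Nat.sub_ne_zero_of_lt hlt), zero_mul]

variable {n : ℕ} {A B : Matrix (Fin n) (Fin n) ℂ}

theorem eval_charpoly_dualMatrix_eq_prod (hAu : IsUnit A) {x w : ℝ} (hx : x ≠ 0) {μ : Fin n → ℝ}
    (h : (A + (w / x) • B).charpoly = ∏ j, (X - C (μ j : ℂ))) :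
    (dualMatrix A B w).charpoly.eval (x : ℂ) = A⁻¹.det * ∏ j, (1 + x * μ j : ℂ) := by
  have hx' : (x : ℂ) ≠ 0 := by exact_mod_cast hx
  rw [eval_charpoly_dualMatrix hAu]
  congr 1
  have h1 := congrArg (fun p : ℂ[X] => p.eval (-(x : ℂ)⁻¹)) h
  simp only [eval_charpoly, eval_prod, eval_sub, eval_X, eval_C] at h1
  have h2 : (1 : ℂ) • (1 : Matrix (Fin n) (Fin n) ℂ) + (x : ℂ) • A + (w : ℂ) • B =
      (-x : ℂ) • (scalar (Fin n) (-(x : ℂ)⁻¹) - (A + (w / x) • B)) := by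
    rw [scalar_apply, ← smul_one_eq_diagonal, smul_sub, smul_smul, smul_add, ← Complex.coe_smul (w / x) B, smul_smul]
    push_cast
    have e1 : -(x : ℂ) * -(x : ℂ)⁻¹ = 1 := by field_simp
    have e2 : -(x : ℂ) * ((w : ℂ) / x) = -w := by field_simp
    rw [e1, e2, neg_smul, neg_smul]
    abel
  rw [h2, det_smul, h1, Fintype.card_fin, ← Fin.prod_const, ← Finset.prod_mul_distrib]
  refine Finset.prod_congr rfl fun j _ => ?_
  field_simp
  ring

theorem eventually_roots_charpoly_dualMatrix (hAu : IsUnit A) {μ v : Fin n → ℝ → ℝ}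
    (hμ : ∀ j, AnalyticAt ℝ (μ j) 0)
    (h : ∀ᶠ t : ℝ in 𝓝 0, (A + t • B).charpoly = ∏ j, (X - C (μ j t : ℂ)))
    (hv : ∀ j, ContinuousAt (v j) 0) (hv0 : ∀ j, v j 0 ≠ 0)
    (hvμ : ∀ j, ∀ᶠ w in 𝓝 (0 : ℝ), 1 + v j w * μ j (w / v j w) = 0) :
    ∀ᶠ w : ℝ in 𝓝 0,
      (dualMatrix A B w).charpoly.roots = Finset.univ.val.map fun j => (v j w : ℂ) := by
  classical
  have hlim : ∀ j, Tendsto (fun w => w / v j w) (𝓝 0) (𝓝 0) := fun j => by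
    have : ContinuousAt (fun w => w / v j w) 0 := continuousAt_id.div (hv j) (hv0 j)
    simpa [ContinuousAt] using this
  have hne : ∀ᶠ w in 𝓝 (0 : ℝ), ∀ j, v j w ≠ 0 :=
    eventually_all.2 fun j => (hv j).eventually_ne (hv0 j)
  have hchar : ∀ᶠ w in 𝓝 (0 : ℝ), ∀ j, ∀ᶠ t in 𝓝 (w / v j w),
      (A + t • B).charpoly = ∏ j, (X - C (μ j t : ℂ)) :=
    eventually_all.2 fun j => (hlim j).eventually (eventually_eventually_nhds.2 h)
  have han : ∀ᶠ w in 𝓝 (0 : ℝ), ∀ j i, AnalyticAt ℝ (μ i) (w / v j w) :=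
    eventually_all.2 fun j => eventually_all.2 fun i =>
      (hlim j).eventually (hμ i).eventually_analyticAt
  filter_upwards [hne, hchar, han, eventually_all.2 hvμ] with w h1 h2 h3 h4
  have hp0 : (dualMatrix A B w).charpoly ≠ 0 := (charpoly_monic _).ne_zero
  refine (Multiset.eq_of_le_of_card_le (Multiset.le_iff_count.2 fun a => ?_) ?_).symm
  · by_cases ha : a ∈ Finset.univ.val.map fun j => (v j w : ℂ)
    · obtain ⟨i, -, rfl⟩ := Multiset.mem_map.1 ha
      have hdiv : ContinuousAt (fun x => w / x) (v i w) := continuousAt_const.div continuousAt_id (h1 i)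
      have hd : ∀ j, DifferentiableAt ℝ (fun x : ℝ => (1 + x * μ j (w / x) : ℂ)) (v i w) := by
        intro j
        have hdd : DifferentiableAt ℝ (fun x : ℝ => w / x) (v i w) :=
          (differentiableAt_const w).div differentiableAt_id (h1 i)
        have hcomp : DifferentiableAt ℝ (fun x : ℝ => 1 + x * μ j (w / x)) (v i w) :=
          (differentiableAt_const _).add (differentiableAt_id.mul
            (DifferentiableAt.comp (g := μ j) (f := fun x : ℝ => w / x) (v i w)
              (h3 i j).differentiableAt hdd))
        have := (Complex.ofRealCLM.differentiableAt (x := 1 + v i w * μ j (w / v i w))).comp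
          (v i w) hcomp
        refine this.congr_of_eventuallyEq (Eventually.of_forall fun x => ?_)
        simp
      have hev : ∀ᶠ x : ℝ in 𝓝 (v i w), (dualMatrix A B w).charpoly.eval (x : ℂ) =
          A⁻¹.det * ∏ j, (1 + x * μ j (w / x) : ℂ) := by
        filter_upwards [hdiv.eventually (h2 i), continuousAt_id.eventually_ne (h1 i)] with x e1 e2
        exact eval_charpoly_dualMatrix_eq_prod hAu e2 e1
      rw [count_roots, Multiset.count_map]
      have := card_le_rootMultiplicity_of_eval_eq_prod hp0 hd hev
        (Finset.univ.filter fun j => (v i w : ℂ) = v j w) (by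
          intro j hj
          have hij : v i w = v j w := by exact_mod_cast (Finset.mem_filter.1 hj).2
          rw [hij]
          exact_mod_cast h4 j)
      exact this
    · rw [Multiset.count_eq_zero_of_notMem ha]
      exact Nat.zero_le _
  · refine (card_roots' _).trans ?_
    rw [charpoly_natDegree_eq_dim]
    simp

theorem signedRootSum_I_of_roots_eq {p : ℂ[X]} {v : Fin n → ℝ}
    (h : p.roots = Finset.univ.val.map fun j => (v j : ℂ)) :
    signedRootSum Complex.I p = ((∑ j, SignType.sign (v j) * v j : ℝ) : ℂ) := by
  rw [signedRootSum, h, Multiset.map_map, Complex.ofReal_sum]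
  change ∑ j, _ = _
  refine Finset.sum_congr rfl fun j _ => ?_
  rcases lt_trichotomy (v j) 0 with h | h | h <;> simp [h]

end Matching

section Positivity

open Polynomial Matrix

variable {n : ℕ} {A B : Matrix (Fin n) (Fin n) ℂ}

theorem sign_eventuallyEq_of_ne_zero {X : Type*} [TopologicalSpace X] {f : X → ℝ} {x : X}
    (hf : ContinuousAt f x) (h : f x ≠ 0) :
    ∀ᶠ y in 𝓝 x, SignType.sign (f y) = SignType.sign (f x) := by
  rcases h.lt_or_gt with h | h
  · filter_upwards [hf.eventually_lt_const h] with y hy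
    rw [sign_neg hy, sign_neg h]
  · filter_upwards [hf.eventually_const_lt h] with y hy
    rw [sign_pos hy, sign_pos h]

theorem abs_pow_three_eq_sign_mul (x : ℝ) : |x| ^ 3 = SignType.sign x * x ^ 3 := by
  rcases lt_trichotomy x 0 with h | rfl | h
  · simp [abs_of_neg h, sign_neg h]
    ring
  · simp
  · simp [abs_of_pos h, sign_pos h]

theorem charpoly_root_ne_zero {M : Matrix (Fin n) (Fin n) ℂ} (hM : IsUnit M) {μ : Fin n → ℝ}
    (h : M.charpoly = ∏ j, (X - C (μ j : ℂ))) (j : Fin n) : μ j ≠ 0 := by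
  intro h0
  have h1 : M.charpoly.eval 0 = 0 := by
    rw [h, eval_prod]
    exact Finset.prod_eq_zero (Finset.mem_univ j) (by simp [h0])
  rw [eval_charpoly, map_zero, zero_sub, det_neg] at h1
  have h2 : M.det ≠ 0 := ((isUnit_iff_isUnit_det M).1 hM).ne_zero
  exact (mul_ne_zero (pow_ne_zero _ (by norm_num)) h2) h1

theorem pencilTrace_eventuallyEq_signed_sum (hA : A.IsHermitian) (hB : B.IsHermitian) {t₀ : ℝ}
    (hAu : IsUnit (A + t₀ • B)) {μ : Fin n → ℝ → ℝ} (hμ : ∀ j, AnalyticAt ℝ (μ j) t₀)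
    (h : ∀ᶠ t : ℝ in 𝓝 t₀, (A + t • B).charpoly = ∏ j, (X - C (μ j t : ℂ))) :
    pencilTrace A B =ᶠ[𝓝 t₀] fun t => ∑ j, SignType.sign (μ j t₀) * μ j t ^ 3 := by
  have hs : ∀ᶠ t in 𝓝 t₀, ∀ j, SignType.sign (μ j t) = SignType.sign (μ j t₀) :=
    eventually_all.2 fun j => sign_eventuallyEq_of_ne_zero (hμ j).continuousAt
      (charpoly_root_ne_zero hAu h.self_of_nhds j)
  filter_upwards [h, hs] with t h1 h2
  rw [pencilTrace_eq_sum hA hB h1]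
  exact Finset.sum_congr rfl fun j _ => by rw [abs_pow_three_eq_sign_mul, h2]

theorem analyticAt_pencilTrace (hA : A.IsHermitian) (hB : B.IsHermitian) {t₀ : ℝ}
    (hAu : IsUnit (A + t₀ • B)) : AnalyticAt ℝ (pencilTrace A B) t₀ := by
  obtain ⟨μ, hμ, h⟩ := exists_analytic_eigenvalues hA hB t₀
  refine AnalyticAt.congr ?_ (pencilTrace_eventuallyEq_signed_sum hA hB hAu hμ h).symm
  exact Finset.analyticAt_fun_sum _ fun j _ => analyticAt_const.mul ((hμ j).pow 3)

theorem iteratedDeriv_sum_const_mul {ι : Type*} [Fintype ι] {f : ι → ℝ → ℝ} {x : ℝ} (k : ℕ)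
    (c : ι → ℝ) (hf : ∀ i, AnalyticAt ℝ (f i) x) :
    iteratedDeriv k (fun t => ∑ i, c i * f i t) x = ∑ i, c i * iteratedDeriv k (f i) x := by
  have hc : ∀ i ∈ Finset.univ, ContDiffAt ℝ k (fun t => c i * f i t) x :=
    fun i _ => contDiffAt_const.mul (hf i).contDiffAt
  rw [iteratedDeriv_fun_sum hc]
  exact Finset.sum_congr rfl fun i _ => iteratedDeriv_const_mul _ (hf i).contDiffAt

theorem iteratedDeriv_four_pencilTrace_zero_nonneg (hA : A.IsHermitian) (hB : B.IsHermitian)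
    (hAu : IsUnit A) : 0 ≤ iteratedDeriv 4 (pencilTrace A B) 0 := by
  obtain ⟨μ, hμ, h⟩ := exists_analytic_eigenvalues hA hB 0
  have hAu' : IsUnit (A + (0 : ℝ) • B) := by rwa [zero_smul, add_zero]
  have hμ0 : ∀ j, μ j 0 ≠ 0 := charpoly_root_ne_zero hAu' h.self_of_nhds
  choose v hv hv0 hvμ h4 using fun j => exists_dual_branch (hμ j) (hμ0 j)
  have hvne : ∀ j, v j 0 ≠ 0 := fun j => by
    rw [hv0]
    exact div_ne_zero (by norm_num) (hμ0 j)
  have hroots := eventually_roots_charpoly_dualMatrix hAu hμ h (fun j => (hv j).continuousAt)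
    hvne hvμ
  have hs : ∀ᶠ w in 𝓝 (0 : ℝ), ∀ j, SignType.sign (v j w) = SignType.sign (v j 0) :=
    eventually_all.2 fun j => sign_eventuallyEq_of_ne_zero (hv j).continuousAt (hvne j)
  have hη : AnalyticAt ℝ (fun w => ∑ j, SignType.sign (v j 0) * v j w) 0 :=
    Finset.analyticAt_fun_sum _ fun j _ => analyticAt_const.mul (hv j)
  have hneg := iteratedDeriv_four_signedRootSum_nonpos hA hB hAu hη (by
    filter_upwards [hroots, hs] with w h1 h2
    rw [signedRootSum_I_of_roots_eq h1]
    simp only [h2])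
  rw [iteratedDeriv_sum_const_mul 4 _ hv] at hneg
  rw [(pencilTrace_eventuallyEq_signed_sum hA hB hAu' hμ h).iteratedDeriv_eq 4,
    iteratedDeriv_sum_const_mul 4 (f := fun j t => μ j t ^ 3) _ fun j => (hμ j).pow 3]
  have hsign : ∀ j, ((SignType.sign (μ j 0) : SignType) : ℝ) = -SignType.sign (v j 0) := fun j => by
    rw [hv0]
    rcases (hμ0 j).lt_or_gt with h | h
    · rw [sign_neg h, sign_pos (div_pos_of_neg_of_neg (by norm_num) h)]
      simp
    · rw [sign_pos h, sign_neg (div_neg_of_neg_of_pos (by norm_num) h)]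
      simp
  have hfin : ∑ j, SignType.sign (μ j 0) * iteratedDeriv 4 (fun t => μ j t ^ 3) 0 =
      -3 * ∑ j, SignType.sign (v j 0) * iteratedDeriv 4 (v j) 0 := by
    rw [Finset.mul_sum]
    refine Finset.sum_congr rfl fun j _ => ?_
    rw [h4, hsign]
    ring
  rw [hfin]
  linarith

theorem iteratedDeriv_four_pencilTrace_nonneg (hA : A.IsHermitian) (hB : B.IsHermitian) {t₀ : ℝ}
    (hAu : IsUnit (A + t₀ • B)) : 0 ≤ iteratedDeriv 4 (pencilTrace A B) t₀ := by
  have h := iteratedDeriv_four_pencilTrace_zero_nonneg (isHermitian_add_smul hA hB t₀) hB hAu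
  have e : pencilTrace (A + t₀ • B) B = fun t => pencilTrace A B (t₀ + t) := by
    funext t
    rw [pencilTrace, pencilTrace, add_smul, add_assoc]
  rw [e, iteratedDeriv_comp_const_add] at h
  simpa using h

end Positivity

section SingularSet

open Polynomial Matrix

variable {n : ℕ} {A B : Matrix (Fin n) (Fin n) ℂ}

theorem isUnit_add_smul_iff (hB : IsUnit B) (t : ℝ) :
    IsUnit (A + t • B) ↔ (B⁻¹ * A).charpoly.eval (-t : ℂ) ≠ 0 := by
  have hBB : B * B⁻¹ = 1 := mul_nonsing_inv B ((isUnit_iff_isUnit_det B).1 hB)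
  have h1 : A + t • B = -(B * (scalar (Fin n) (-t : ℂ) - B⁻¹ * A)) := by
    rw [mul_sub, ← mul_assoc, hBB, one_mul, scalar_apply, ← smul_one_eq_diagonal,
      Matrix.mul_smul, mul_one, neg_smul, Complex.coe_smul]
    abel
  rw [h1, IsUnit.neg_iff, hB.mul_left_iff, isUnit_iff_isUnit_det, isUnit_iff_ne_zero,
    eval_charpoly]

theorem finite_setOf_not_isUnit_add_smul (hB : IsUnit B) :
    {t : ℝ | ¬ IsUnit (A + t • B)}.Finite := by
  have h1 : {t : ℝ | ¬ IsUnit (A + t • B)} =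
      (fun t : ℝ => (-t : ℂ)) ⁻¹' {z | (B⁻¹ * A).charpoly.IsRoot z} := by
    ext t
    simp [isUnit_add_smul_iff hB]
  rw [h1]
  refine Set.Finite.preimage (fun x _ y _ h => ?_)
    (finite_setOfPred_isRoot (charpoly_monic _).ne_zero)
  exact_mod_cast neg_injective h

end SingularSet

section AbsPow

theorem hasDerivAt_pow_succ_mul_abs (k : ℕ) (x : ℝ) :
    HasDerivAt (fun x : ℝ => x ^ (k + 1) * |x|) ((k + 2) * (x ^ k * |x|)) x := by
  rcases eq_or_ne x 0 with rfl | hx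
  · rw [abs_zero, mul_zero, mul_zero, hasDerivAt_iff_tendsto_slope]
    have h1 : Tendsto (fun x : ℝ => x ^ k * |x|) (𝓝[≠] 0) (𝓝 0) := by
      have : Continuous fun x : ℝ => x ^ k * |x| := by fun_prop
      simpa using (this.tendsto 0).mono_left (nhdsWithin_le_nhds (s := {0}ᶜ))
    refine h1.congr' ?_
    filter_upwards [self_mem_nhdsWithin] with y hy
    have hy : y ≠ 0 := hy
    rw [slope_def_field]
    field_simp
    simp
    ring
  · have h1 := (hasDerivAt_pow (k + 1) x).mul (hasDerivAt_abs hx)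
    refine h1.congr_deriv ?_
    have h2 : |x| = SignType.sign x * x := (sign_mul_self x).symm
    rw [h2]
    push_cast
    ring

theorem deriv_pow_succ_mul_abs (k : ℕ) :
    deriv (fun x : ℝ => x ^ (k + 1) * |x|) = fun x : ℝ => (k + 2) * (x ^ k * |x|) :=
  funext fun x => (hasDerivAt_pow_succ_mul_abs k x).deriv

theorem contDiff_pow_mul_abs (k : ℕ) : ContDiff ℝ k fun x : ℝ => x ^ k * |x| := by
  induction k with
  | zero =>
    simp only [CharP.cast_eq_zero, contDiff_zero]
    fun_prop
  | succ k ih =>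
    rw [Nat.cast_succ, contDiff_succ_iff_deriv, deriv_pow_succ_mul_abs]
    exact ⟨fun x => (hasDerivAt_pow_succ_mul_abs k x).differentiableAt, by simp,
      contDiff_const.mul ih⟩

theorem contDiffAt_pow_mul_abs {k : ℕ} {x : ℝ} (hx : x ≠ 0) {m : ℕ∞} :
    ContDiffAt ℝ m (fun x : ℝ => x ^ k * |x|) x :=
  (contDiffAt_id.pow k).mul (contDiffAt_abs hx)

theorem abs_pow_three_eq (x : ℝ) : |x| ^ 3 = x ^ 2 * |x| := by
  rw [pow_succ, sq_abs]

end AbsPow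

section LocalForm

theorem AnalyticAt.abs_pow_three_eq_add {μ : ℝ → ℝ} {c : ℝ} (hμ : AnalyticAt ℝ μ c) :
    ∃ a b : ℝ → ℝ, AnalyticAt ℝ a c ∧ AnalyticAt ℝ b c ∧ 0 ≤ b c ∧
      ∀ᶠ t in 𝓝 c, |μ t| ^ 3 = a t + |t - c| ^ 3 * b t := by
  by_cases h : ∀ᶠ t in 𝓝 c, μ t = 0
  · refine ⟨fun _ => 0, fun _ => 0, analyticAt_const, analyticAt_const, le_rfl, ?_⟩
    filter_upwards [h] with t ht
    simp [ht]
  · obtain ⟨k, g, hg, hg0, hμg⟩ := hμ.exists_eventuallyEq_pow_smul_nonzero_iff.2 h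
    have hs := sign_eventuallyEq_of_ne_zero hg.continuousAt hg0
    have hx : AnalyticAt ℝ (fun t => t - c) c := analyticAt_id.sub analyticAt_const
    have hG : AnalyticAt ℝ (fun t => SignType.sign (g c) * g t ^ 3) c :=
      analyticAt_const.mul (hg.pow 3)
    have habs : ∀ᶠ t in 𝓝 c, |μ t| ^ 3 = |t - c| ^ (3 * k) * (SignType.sign (g c) * g t ^ 3) := by
      filter_upwards [hμg, hs] with t h1 h2
      rw [h1, smul_eq_mul, abs_mul, mul_pow, abs_pow_three_eq_sign_mul (g t), h2, abs_pow,
        ← pow_mul, mul_comm k]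
    rcases Nat.even_or_odd k with hk | hk
    · refine ⟨fun t => (t - c) ^ (3 * k) * (SignType.sign (g c) * g t ^ 3), fun _ => 0,
        (hx.pow _).mul hG, analyticAt_const, le_rfl, ?_⟩
      filter_upwards [habs] with t ht
      rw [ht, (hk.mul_left 3).pow_abs, mul_zero, add_zero]
    · obtain ⟨m, rfl⟩ := hk
      refine ⟨fun _ => 0, fun t => (t - c) ^ (6 * m) * (SignType.sign (g c) * g t ^ 3),
        analyticAt_const, (hx.pow _).mul hG, ?_, ?_⟩
      · beta_reduce
        rw [← abs_pow_three_eq_sign_mul]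
        have : Even (6 * m) := (by decide : Even 6).mul_right m
        exact mul_nonneg (this.pow_nonneg _) (by positivity)
      · filter_upwards [habs] with t ht
        have : Even (6 * m) := (by decide : Even 6).mul_right m
        rw [ht, ← this.pow_abs]
        ring

variable {n : ℕ} {A B : Matrix (Fin n) (Fin n) ℂ}

theorem pencilTrace_local_form (hA : A.IsHermitian) (hB : B.IsHermitian) (c : ℝ) :
    ∃ C D : ℝ, 0 ≤ C ∧ ∃ f : ℝ → ℝ, ContDiffAt ℝ 4 f c ∧
      ∀ᶠ t in 𝓝 c, pencilTrace A B t =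
        C * |t - c| ^ 3 + D * (|t - c| ^ 3 * (t - c)) + f t := by
  obtain ⟨μ, hμ, h⟩ := exists_analytic_eigenvalues hA hB c
  choose a b ha hb hb0 hab using fun j => (hμ j).abs_pow_three_eq_add
  have hb' : AnalyticAt ℝ (fun t => ∑ j, b j t) c := Finset.analyticAt_fun_sum _ fun j _ => hb j
  have ha' : AnalyticAt ℝ (fun t => ∑ j, a j t) c := Finset.analyticAt_fun_sum _ fun j _ => ha j
  set β : ℝ → ℝ := fun t => ∑ j, b j t
  have h1 : AnalyticAt ℝ (dslope β c) c := hb'.dslope_self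
  have h2 : AnalyticAt ℝ (dslope (dslope β c) c) c := h1.dslope_self
  refine ⟨β c, dslope β c c, Finset.sum_nonneg fun j _ => hb0 j,
    fun t => ∑ j, a j t + (t - c) ^ 4 * |t - c| * dslope (dslope β c) c t, ?_, ?_⟩
  · have h3 : ContDiffAt ℝ 4 (fun t : ℝ => (t - c) ^ 4 * |t - c|) c :=
      ((contDiff_pow_mul_abs 4).comp (contDiff_id.sub contDiff_const)).contDiffAt
    exact ha'.contDiffAt.add (h3.mul h2.contDiffAt)
  · filter_upwards [h, eventually_all.2 hab] with t ht hab
    rw [pencilTrace_eq_sum hA hB ht, Finset.sum_congr rfl fun j _ => hab j,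
      Finset.sum_add_distrib, ← Finset.mul_sum]
    have e1 := sub_smul_dslope β c t
    have e2 := sub_smul_dslope (dslope β c) c t
    rw [smul_eq_mul] at e1 e2
    have e3 : ∑ j, b j t =
        β c + (t - c) * (dslope β c c + (t - c) * dslope (dslope β c) c t) := by
      rw [e2, add_sub_cancel, e1]
      ring
    rw [e3, abs_pow_three_eq]
    ring

end LocalForm

section IntegrationByParts

theorem integrable_continuous_mul_of_hasCompactSupport {u φ : ℝ → ℝ} (hu : LocallyIntegrable u)
    (hφ : Continuous φ) (hs : HasCompactSupport φ) : Integrable fun t => u t * φ t := by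
  simpa only [smul_eq_mul, mul_comm] using hu.integrable_smul_left_of_hasCompactSupport hφ hs

theorem integral_mul_deriv_eq_neg {u u' φ : ℝ → ℝ} (hu : ∀ x, HasDerivAt u (u' x) x)
    (hu' : Continuous u') (hφ : ContDiff ℝ 1 φ) (hs : HasCompactSupport φ) :
    ∫ t, u t * deriv φ t = -∫ t, u' t * φ t := by
  have huc : Continuous u := continuous_iff_continuousAt.2 fun x => (hu x).continuousAt
  exact integral_mul_deriv_eq_deriv_mul_of_integrable (fun x _ => hu x)
    (fun x _ => (hφ.differentiable one_ne_zero x).hasDerivAt)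
    (integrable_continuous_mul_of_hasCompactSupport huc.locallyIntegrable
      (hφ.continuous_deriv le_rfl) hs.deriv)
    (integrable_continuous_mul_of_hasCompactSupport hu'.locallyIntegrable hφ.continuous hs)
    (integrable_continuous_mul_of_hasCompactSupport huc.locallyIntegrable hφ.continuous hs)

theorem HasCompactSupport.iteratedDeriv_real {φ : ℝ → ℝ} (hs : HasCompactSupport φ) (k : ℕ) :
    HasCompactSupport (iteratedDeriv k φ) := by
  induction k with
  | zero => rwa [iteratedDeriv_zero]
  | succ k ih =>
    rw [iteratedDeriv_succ]
    exact ih.deriv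

theorem ContDiff.iteratedDeriv_of_infty {φ : ℝ → ℝ} (hφ : ContDiff ℝ ∞ φ) (k : ℕ) :
    ContDiff ℝ ∞ (iteratedDeriv k φ) := by
  induction k with
  | zero => rwa [iteratedDeriv_zero]
  | succ k ih =>
    rw [iteratedDeriv_succ]
    exact (contDiff_infty_iff_deriv.1 ih).2

variable {φ : ℝ → ℝ}

theorem integral_mul_iteratedDeriv_succ {u u' : ℝ → ℝ} (hu : ∀ x, HasDerivAt u (u' x) x)
    (hu' : Continuous u') (hφ : ContDiff ℝ ∞ φ) (hs : HasCompactSupport φ) (k : ℕ) :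
    ∫ t, u t * iteratedDeriv (k + 1) φ t = -∫ t, u' t * iteratedDeriv k φ t := by
  rw [iteratedDeriv_succ]
  exact integral_mul_deriv_eq_neg hu hu' ((hφ.iteratedDeriv_of_infty k).of_le (by simp))
    (hs.iteratedDeriv_real k)

theorem integral_mul_iteratedDeriv {g : ℝ → ℝ} {k : ℕ} (hg : ContDiff ℝ k g)
    (hφ : ContDiff ℝ ∞ φ) (hs : HasCompactSupport φ) :
    ∫ t, g t * iteratedDeriv k φ t = (-1) ^ k * ∫ t, iteratedDeriv k g t * φ t := by
  have key : ∀ i ≤ k, ∫ t, g t * iteratedDeriv k φ t =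
      (-1) ^ i * ∫ t, iteratedDeriv i g t * iteratedDeriv (k - i) φ t := by
    intro i
    induction i with
    | zero => simp
    | succ i ih =>
      intro hi
      rw [ih (by omega), show k - i = k - (i + 1) + 1 by omega,
        integral_mul_iteratedDeriv_succ (u' := iteratedDeriv (i + 1) g) ?_
          (hg.continuous_iteratedDeriv (i + 1) (by exact_mod_cast hi)) hφ hs]
      · ring
      · intro x
        rw [iteratedDeriv_succ]
        exact ((hg.differentiable_iteratedDeriv i (by exact_mod_cast hi)) x).hasDerivAt
  simpa using key k le_rfl

theorem locallyIntegrable_sign_sub (c : ℝ) :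
    LocallyIntegrable fun t : ℝ => ((SignType.sign (t - c) : SignType) : ℝ) := by
  refine (locallyIntegrable_const (1 : ℝ)).mono ?_ (Eventually.of_forall fun t => ?_)
  · have h : Measurable fun t : ℝ => ((SignType.sign (t - c) : SignType) : ℝ) := by
      have : (fun t : ℝ => ((SignType.sign (t - c) : SignType) : ℝ)) =
          fun t => deriv (fun x : ℝ => |x|) (t - c) := by
        funext t
        rw [deriv_abs]
      rw [this]
      exact (measurable_deriv _).comp (measurable_id.sub_const c)
    exact h.aestronglyMeasurable
  · rcases lt_trichotomy (t - c) 0 with h | h | h <;> simp [h]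

theorem integral_sign_mul_deriv (hφ : ContDiff ℝ 1 φ) (hs : HasCompactSupport φ) (c : ℝ) :
    ∫ t, SignType.sign (t - c) * deriv φ t = -2 * φ c := by
  have hint : Integrable fun t => SignType.sign (t - c) * deriv φ t :=
    integrable_continuous_mul_of_hasCompactSupport (locallyIntegrable_sign_sub c)
      (hφ.continuous_deriv le_rfl) hs.deriv
  have hu : Set.Iic c ∪ Set.Ioi c = Set.univ := Set.Iic_union_Ioi
  rw [← setIntegral_univ, ← hu, setIntegral_union (Set.Iic_disjoint_Ioi le_rfl) measurableSet_Ioi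
    hint.integrableOn hint.integrableOn]
  have h1 : ∫ t in Set.Ioi c, SignType.sign (t - c) * deriv φ t = -φ c := by
    rw [← hs.integral_Ioi_deriv_eq hφ c]
    refine setIntegral_congr_fun measurableSet_Ioi fun t ht => ?_
    have h : 0 < t - c := sub_pos.2 ht
    simp [h]
  have h2 : ∫ t in Set.Iic c, SignType.sign (t - c) * deriv φ t = -φ c := by
    rw [← hs.integral_Iic_deriv_eq hφ c, ← integral_neg, integral_Iic_eq_integral_Iio,
      integral_Iic_eq_integral_Iio]
    refine setIntegral_congr_fun measurableSet_Iio fun t ht => ?_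
    have h : t - c < 0 := sub_neg.2 ht
    simp [h]
  rw [h1, h2]
  ring

theorem integral_abs_mul_deriv (hφ : ContDiff ℝ 1 φ) (hs : HasCompactSupport φ) (c : ℝ) :
    ∫ t, |t - c| * deriv φ t = -∫ t, SignType.sign (t - c) * φ t := by
  have hx : ContDiff ℝ 1 fun t : ℝ => t - c := contDiff_id.sub contDiff_const
  have h := integral_sign_mul_deriv (φ := fun t => (t - c) * φ t) (hx.mul hφ) hs.mul_left c
  have hd : ∀ t, deriv (fun t => (t - c) * φ t) t = φ t + (t - c) * deriv φ t := fun t => by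
    have := ((hasDerivAt_id t).sub_const c).mul (hφ.differentiable one_ne_zero t).hasDerivAt
    rw [one_mul] at this
    exact this.deriv
  have he : ∀ t, SignType.sign (t - c) * deriv (fun t => (t - c) * φ t) t =
      SignType.sign (t - c) * φ t + |t - c| * deriv φ t := fun t => by
    rw [hd, mul_add, ← mul_assoc, sign_mul_self]
  have hc : Continuous fun t : ℝ => |t - c| := by fun_prop
  simp only [he] at h
  rw [integral_add (integrable_continuous_mul_of_hasCompactSupport (locallyIntegrable_sign_sub c)
      hφ.continuous hs)
    (integrable_continuous_mul_of_hasCompactSupport hc.locallyIntegrable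
      (hφ.continuous_deriv le_rfl) hs.deriv), sub_self, zero_mul, mul_zero] at h
  linarith

theorem integral_pow_succ_mul_abs_mul_iteratedDeriv_succ (hφ : ContDiff ℝ ∞ φ)
    (hs : HasCompactSupport φ) (c : ℝ) (j k : ℕ) :
    ∫ t, (t - c) ^ (j + 1) * |t - c| * iteratedDeriv (k + 1) φ t =
      -(j + 2) * ∫ t, (t - c) ^ j * |t - c| * iteratedDeriv k φ t := by
  rw [integral_mul_iteratedDeriv_succ (u := fun t => (t - c) ^ (j + 1) * |t - c|)
    (fun x => (hasDerivAt_pow_succ_mul_abs j (x - c)).comp_sub_const x c) (by fun_prop) hφ hs,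
    neg_mul, ← integral_const_mul]
  congr 2
  funext t
  ring

theorem integral_sq_mul_abs_mul_iteratedDeriv_four (hφ : ContDiff ℝ ∞ φ)
    (hs : HasCompactSupport φ) (c : ℝ) :
    ∫ t, (t - c) ^ 2 * |t - c| * iteratedDeriv 4 φ t = 12 * φ c := by
  have h1 := integral_pow_succ_mul_abs_mul_iteratedDeriv_succ hφ hs c 1 3
  have h2 := integral_pow_succ_mul_abs_mul_iteratedDeriv_succ hφ hs c 0 2
  have h3 := integral_abs_mul_deriv (φ := iteratedDeriv 1 φ)
    ((hφ.iteratedDeriv_of_infty 1).of_le (by simp)) (hs.iteratedDeriv_real 1) c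
  rw [← iteratedDeriv_succ, iteratedDeriv_one, integral_sign_mul_deriv (hφ.of_le (by simp)) hs] at h3
  simp only [pow_zero, one_mul] at h2
  norm_num at h1 h2 h3
  rw [h1, h2, h3]
  ring

theorem integral_cube_mul_abs_mul_iteratedDeriv_four (hφ : ContDiff ℝ ∞ φ)
    (hs : HasCompactSupport φ) (c : ℝ) :
    ∫ t, (t - c) ^ 3 * |t - c| * iteratedDeriv 4 φ t =
      24 * ∫ t, SignType.sign (t - c) * φ t := by
  have h0 := integral_pow_succ_mul_abs_mul_iteratedDeriv_succ hφ hs c 2 3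
  have h1 := integral_pow_succ_mul_abs_mul_iteratedDeriv_succ hφ hs c 1 2
  have h2 := integral_pow_succ_mul_abs_mul_iteratedDeriv_succ hφ hs c 0 1
  have h3 := integral_abs_mul_deriv (hφ.of_le (by simp)) hs c
  simp only [pow_zero, one_mul] at h2
  norm_num at h0 h1 h2
  rw [h0, h1, h2, h3]
  ring

end IntegrationByParts

section IteratedDeriv

theorem iteratedDeriv_four_cube_mul_abs (x : ℝ) :
    iteratedDeriv 4 (fun x : ℝ => x ^ 3 * |x|) x = 24 * SignType.sign x := by
  have h1 : deriv (fun x : ℝ => x ^ 1 * |x|) = fun x => 2 * |x| := by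
    simpa using deriv_pow_succ_mul_abs 0
  have h2 := deriv_pow_succ_mul_abs 1
  have h3 := deriv_pow_succ_mul_abs 2
  norm_num at h2 h3
  simp only [pow_one] at h1
  simp only [iteratedDeriv_succ', iteratedDeriv_zero, h3, deriv_const_mul_field', h2, h1, deriv_abs]
  ring

theorem iteratedDeriv_four_sq_mul_abs {x : ℝ} (hx : x ≠ 0) :
    iteratedDeriv 4 (fun x : ℝ => x ^ 2 * |x|) x = 0 := by
  have h1 : deriv (fun x : ℝ => x ^ 1 * |x|) = fun x => 2 * |x| := by
    simpa using deriv_pow_succ_mul_abs 0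
  have h2 := deriv_pow_succ_mul_abs 1
  norm_num at h2
  simp only [pow_one] at h1
  simp only [iteratedDeriv_succ', iteratedDeriv_zero, h2, deriv_const_mul_field', h1, deriv_abs]
  have h4 : (fun y : ℝ => ((SignType.sign y : SignType) : ℝ)) =ᶠ[𝓝 x] fun _ => (SignType.sign x : ℝ) := by
    filter_upwards [sign_eventuallyEq_of_ne_zero (f := fun y => y) continuousAt_id hx] with y hy
    rw [hy]
  rw [h4.deriv_eq]
  simp

end IteratedDeriv

section DistributionalDerivative

theorem isLocallyFiniteMeasure_withDensity_ofReal {h : ℝ → ℝ} (hh : LocallyIntegrable h) :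
    IsLocallyFiniteMeasure (volume.withDensity fun t => ENNReal.ofReal (h t)) := by
  refine ⟨fun x => ?_⟩
  obtain ⟨U, hU, hi⟩ := hh x
  obtain ⟨V, hVU, hV, hx⟩ := mem_nhds_iff.1 hU
  refine ⟨V, hV.mem_nhds hx, ?_⟩
  rw [withDensity_apply _ hV.measurableSet]
  exact Integrable.lintegral_lt_top (hi.mono_set hVU)

theorem integral_withDensity_ofReal_of_ae_nonneg {h φ : ℝ → ℝ} (hm : AEMeasurable h)
    (h0 : 0 ≤ᵐ[volume] h) :
    ∫ t, φ t ∂(volume.withDensity fun t => ENNReal.ofReal (h t)) = ∫ t, h t * φ t := by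
  rw [integral_withDensity_eq_integral_toReal_smul₀ hm.ennreal_ofReal
    (Eventually.of_forall fun _ => ENNReal.ofReal_lt_top)]
  refine integral_congr_ae ?_
  filter_upwards [h0] with t ht
  rw [ENNReal.toReal_ofReal ht, smul_eq_mul]

theorem isLocallyFiniteMeasure_add {X : Type*} [TopologicalSpace X] [MeasurableSpace X]
    (μ ν : Measure X) [IsLocallyFiniteMeasure μ] [IsLocallyFiniteMeasure ν] :
    IsLocallyFiniteMeasure (μ + ν) := by
  refine ⟨fun x => ?_⟩
  obtain ⟨U, hU, hμU⟩ := μ.finiteAt_nhds x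
  obtain ⟨V, hV, hνV⟩ := ν.finiteAt_nhds x
  refine ⟨U ∩ V, inter_mem hU hV, ?_⟩
  rw [Measure.add_apply]
  exact ENNReal.add_lt_top.2 ⟨(measure_mono Set.inter_subset_left).trans_lt hμU,
    (measure_mono Set.inter_subset_right).trans_lt hνV⟩

variable {T g : ℝ → ℝ} {S : Finset ℝ} {C D : ℝ → ℝ}

theorem iteratedDeriv_four_of_eq_add_sum (hg : ContDiff ℝ 4 g)
    (hT : ∀ t, T t = g t + ∑ c ∈ S, (C c * ((t - c) ^ 2 * |t - c|) + D c * ((t - c) ^ 3 * |t - c|)))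
    {t : ℝ} (ht : t ∉ S) :
    iteratedDeriv 4 T t = iteratedDeriv 4 g t + ∑ c ∈ S, D c * (24 * SignType.sign (t - c)) := by
  have hne : ∀ c ∈ S, t - c ≠ 0 := fun c hc h => ht (sub_eq_zero.1 h ▸ hc)
  have hp : ∀ (k : ℕ), ∀ c ∈ S, ContDiffAt ℝ (4 : ℕ) (fun t => (t - c) ^ k * |t - c|) t :=
    fun k c hc => ContDiffAt.comp (g := fun x : ℝ => x ^ k * |x|) t
      (contDiffAt_pow_mul_abs (m := ((4 : ℕ) : ℕ∞)) (hne c hc))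
      (contDiffAt_id.sub contDiffAt_const)
  have hC : ∀ c ∈ S, ContDiffAt ℝ (4 : ℕ) (fun t => C c * ((t - c) ^ 2 * |t - c|)) t :=
    fun c hc => contDiffAt_const.mul (hp 2 c hc)
  have hD : ∀ c ∈ S, ContDiffAt ℝ (4 : ℕ) (fun t => D c * ((t - c) ^ 3 * |t - c|)) t :=
    fun c hc => contDiffAt_const.mul (hp 3 c hc)
  have hCD := fun c hc => (hC c hc).add (hD c hc)
  rw [funext hT, iteratedDeriv_fun_add (by exact_mod_cast hg.contDiffAt)
    (ContDiffAt.sum fun c hc => hCD c hc), iteratedDeriv_fun_sum hCD]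
  congr 1
  refine Finset.sum_congr rfl fun c hc => ?_
  rw [iteratedDeriv_fun_add (hC c hc) (hD c hc), iteratedDeriv_const_mul _ (hp 2 c hc),
    iteratedDeriv_const_mul _ (hp 3 c hc),
    iteratedDeriv_comp_sub_const 4 (fun x : ℝ => x ^ 2 * |x|) c,
    iteratedDeriv_comp_sub_const 4 (fun x : ℝ => x ^ 3 * |x|) c]
  beta_reduce
  rw [iteratedDeriv_four_sq_mul_abs (hne c hc), iteratedDeriv_four_cube_mul_abs, mul_zero, zero_add]

theorem hasDistribDerivMeasure_four_of_eq_add_sum (hg : ContDiff ℝ 4 g)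
    (hT : ∀ t, T t = g t + ∑ c ∈ S, (C c * ((t - c) ^ 2 * |t - c|) + D c * ((t - c) ^ 3 * |t - c|)))
    (hC : ∀ c ∈ S, 0 ≤ C c) (hT4 : ∀ t ∉ S, 0 ≤ iteratedDeriv 4 T t) :
    HasDistribDerivMeasure 4 T
      (volume.withDensity (fun t => ENNReal.ofReal (iteratedDeriv 4 T t)) +
        ∑ c ∈ S, ENNReal.ofReal (12 * C c) • Measure.dirac c) := by
  set h : ℝ → ℝ := fun t =>
    iteratedDeriv 4 g t + ∑ c ∈ S, D c * (24 * SignType.sign (t - c)) with hh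
  have hgc : Continuous (iteratedDeriv 4 g) := hg.continuous_iteratedDeriv 4 le_rfl
  have hsum : LocallyIntegrable fun t => ∑ c ∈ S, D c * (24 * SignType.sign (t - c) : ℝ) :=
    locallyIntegrable_finsetSum _ fun c _ => by
      have := (locallyIntegrable_sign_sub c).smul (D c * 24)
      simpa [Pi.smul_def, mul_assoc] using this
  have hhi : LocallyIntegrable h := hgc.locallyIntegrable.add hsum
  have hS : ∀ᵐ t : ℝ, t ∉ S := by
    have : volume (S : Set ℝ) = 0 := S.finite_toSet.measure_zero _
    exact measure_eq_zero_iff_ae_notMem.1 this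
  have hTh : iteratedDeriv 4 T =ᵐ[volume] h := by
    filter_upwards [hS] with t ht
    exact iteratedDeriv_four_of_eq_add_sum hg hT ht
  have hnonneg : 0 ≤ᵐ[volume] h := by
    filter_upwards [hS, hTh] with t h1 h2
    rw [← h2]
    exact hT4 t h1
  have hdens : volume.withDensity (fun t => ENNReal.ofReal (iteratedDeriv 4 T t)) =
      volume.withDensity fun t => ENNReal.ofReal (h t) :=
    withDensity_congr_ae (hTh.mono fun t ht => by beta_reduce; rw [ht])
  have hTc : Continuous T := by
    have := hg.continuous
    rw [funext hT]
    fun_prop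
  have hlf := isLocallyFiniteMeasure_withDensity_ofReal hhi
  have hfin : IsFiniteMeasure (∑ c ∈ S, ENNReal.ofReal (12 * C c) • Measure.dirac c) := by
    refine ⟨?_⟩
    simp [ENNReal.sum_lt_top, ENNReal.mul_lt_top]
  rw [hdens]
  refine ⟨hTc.locallyIntegrable, isLocallyFiniteMeasure_add _ _, fun φ hφ hs => ?_⟩
  have hφ4c := (hφ.iteratedDeriv_of_infty 4).continuous
  have hφ4s := hs.iteratedDeriv_real 4
  have hI : ∀ {u : ℝ → ℝ}, Continuous u → Integrable fun t => u t * iteratedDeriv 4 φ t :=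
    fun hu => integrable_continuous_mul_of_hasCompactSupport hu.locallyIntegrable hφ4c hφ4s
  have hφi : ∀ (μ : Measure ℝ) [IsLocallyFiniteMeasure μ], Integrable φ μ :=
    fun μ _ => hφ.continuous.integrable_of_hasCompactSupport hs
  have hleft : ∫ t, T t * iteratedDeriv 4 φ t = (∫ t, iteratedDeriv 4 g t * φ t) +
      ∑ c ∈ S, (C c * (12 * φ c) + D c * (24 * ∫ t, SignType.sign (t - c) * φ t)) := by
    have hk : ∀ (k : ℕ) (a c : ℝ),
        Integrable fun t => a * ((t - c) ^ k * |t - c| * iteratedDeriv 4 φ t) :=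
      fun k a c => (hI (u := fun t => (t - c) ^ k * |t - c|) (by fun_prop)).const_mul a
    have hCD : ∀ c ∈ S, Integrable fun t => C c * ((t - c) ^ 2 * |t - c| * iteratedDeriv 4 φ t) +
        D c * ((t - c) ^ 3 * |t - c| * iteratedDeriv 4 φ t) :=
      fun c _ => (hk 2 (C c) c).add (hk 3 (D c) c)
    have e : ∀ t, T t * iteratedDeriv 4 φ t = g t * iteratedDeriv 4 φ t +
        ∑ c ∈ S, (C c * ((t - c) ^ 2 * |t - c| * iteratedDeriv 4 φ t) +
          D c * ((t - c) ^ 3 * |t - c| * iteratedDeriv 4 φ t)) := fun t => by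
      rw [hT, add_mul, Finset.sum_mul]
      congr 1
      refine Finset.sum_congr rfl fun c _ => ?_
      ring
    simp only [e]
    rw [integral_add (hI hg.continuous) (integrable_finsetSum _ hCD), integral_finsetSum _ hCD,
      integral_mul_iteratedDeriv (k := 4) (by exact_mod_cast hg) hφ hs]
    congr 1
    · norm_num
    · refine Finset.sum_congr rfl fun c _ => ?_
      rw [integral_add (hk 2 (C c) c) (hk 3 (D c) c), integral_const_mul, integral_const_mul,
        integral_sq_mul_abs_mul_iteratedDeriv_four hφ hs,
        integral_cube_mul_abs_mul_iteratedDeriv_four hφ hs]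
  have hdensint : ∫ t, h t * φ t = (∫ t, iteratedDeriv 4 g t * φ t) +
      ∑ c ∈ S, D c * (24 * ∫ t, SignType.sign (t - c) * φ t) := by
    have hk : ∀ c, Integrable fun t => D c * (24 * (SignType.sign (t - c) * φ t)) := fun c =>
      ((integrable_continuous_mul_of_hasCompactSupport (locallyIntegrable_sign_sub c)
        hφ.continuous hs).const_mul 24).const_mul (D c)
    have e : ∀ t, h t * φ t = iteratedDeriv 4 g t * φ t +
        ∑ c ∈ S, D c * (24 * (SignType.sign (t - c) * φ t)) := fun t => by
      rw [hh, add_mul, Finset.sum_mul]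
      congr 1
      refine Finset.sum_congr rfl fun c _ => ?_
      ring
    simp only [e]
    rw [integral_add (integrable_continuous_mul_of_hasCompactSupport hgc.locallyIntegrable
      hφ.continuous hs) (integrable_finsetSum _ fun c _ => hk c),
      integral_finsetSum _ fun c _ => hk c]
    congr 1
    refine Finset.sum_congr rfl fun c _ => ?_
    rw [integral_const_mul, integral_const_mul]
  rw [hleft, integral_add_measure (hφi _) (hφi _),
    integral_withDensity_ofReal_of_ae_nonneg hhi.aestronglyMeasurable.aemeasurable hnonneg,
    hdensint, integral_finsetSum_measure fun c _ => (hφi _).smul_measure ENNReal.ofReal_ne_top,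
    Finset.sum_add_distrib]
  have hdirac : ∑ c ∈ S, ∫ t, φ t ∂(ENNReal.ofReal (12 * C c) • Measure.dirac c) =
      ∑ c ∈ S, C c * (12 * φ c) := Finset.sum_congr rfl fun c hc => by
    rw [integral_smul_measure, integral_dirac,
      ENNReal.toReal_ofReal (mul_nonneg (by norm_num) (hC c hc)), smul_eq_mul]
    ring
  rw [hdirac]
  ring

end DistributionalDerivative

theorem mainTheorem6 (n : ℕ) (A B : Matrix (Fin n) (Fin n) ℂ)
    (hA : A.IsHermitian) (hB : B.IsHermitian) (hBinv : IsUnit B) :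
    ∃ S : Finset ℝ, (∀ t : ℝ, t ∈ S ↔ ¬ IsUnit (A + t • B)) ∧
      (∀ t : ℝ, t ∉ S → AnalyticAt ℝ (pencilTrace A B) t) ∧
      (∀ t : ℝ, t ∉ S → 0 ≤ iteratedDeriv 4 (pencilTrace A B) t) ∧
      ∃ C : ℝ → ℝ,
        (∀ c ∈ S, 0 ≤ C c ∧ ∃ (D : ℝ) (f : ℝ → ℝ), ContDiffAt ℝ 4 f c ∧
          ∀ᶠ t in 𝓝 c, pencilTrace A B t =
            C c * |t - c| ^ 3 + D * (|t - c| ^ 3 * (t - c)) + f t) ∧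
        HasDistribDerivMeasure 4 (pencilTrace A B)
          (volume.withDensity (fun t => ENNReal.ofReal (iteratedDeriv 4 (pencilTrace A B) t)) +
            ∑ c ∈ S, ENNReal.ofReal (12 * C c) • Measure.dirac c) := by
  have hfin := finite_setOf_not_isUnit_add_smul (A := A) hBinv
  choose C D hC f hf hloc using pencilTrace_local_form hA hB
  have hmem : ∀ t : ℝ, t ∈ hfin.toFinset ↔ ¬ IsUnit (A + t • B) := fun t => by simp
  have hunit : ∀ t : ℝ, t ∉ hfin.toFinset → IsUnit (A + t • B) := fun t ht =>
    not_not.1 fun h => ht ((hmem t).2 h)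
  have hpos : ∀ t : ℝ, t ∉ hfin.toFinset → 0 ≤ iteratedDeriv 4 (pencilTrace A B) t :=
    fun t ht => iteratedDeriv_four_pencilTrace_nonneg hA hB (hunit t ht)
  refine ⟨hfin.toFinset, hmem, fun t ht => analyticAt_pencilTrace hA hB (hunit t ht), hpos, C,
    fun c _ => ⟨hC c, D c, f c, hf c, hloc c⟩, ?_⟩
  set S := hfin.toFinset
  let q : ℝ → ℝ → ℝ := fun c t => C c * ((t - c) ^ 2 * |t - c|) + D c * ((t - c) ^ 3 * |t - c|)
  have hq : ∀ c t, t ≠ c → ContDiffAt ℝ 4 (q c) t := fun c t hne => by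
    have hp : ∀ k : ℕ, ContDiffAt ℝ 4 (fun t => (t - c) ^ k * |t - c|) t := fun k =>
      ContDiffAt.comp (g := fun x : ℝ => x ^ k * |x|) t
        (contDiffAt_pow_mul_abs (m := 4) (sub_ne_zero.2 hne))
        (contDiffAt_id.sub contDiffAt_const)
    exact (contDiffAt_const.mul (hp 2)).add (contDiffAt_const.mul (hp 3))
  have hg : ContDiff ℝ 4 fun t => pencilTrace A B t - ∑ c ∈ S, q c t := by
    refine contDiff_iff_contDiffAt.2 fun t => ?_
    by_cases ht : t ∈ S
    · have h1 : ContDiffAt ℝ 4 (fun s => f t s - ∑ c ∈ S.erase t, q c s) t :=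
        (hf t).sub (ContDiffAt.sum fun c hc => hq c t (Finset.ne_of_mem_erase hc).symm)
      refine h1.congr_of_eventuallyEq ?_
      filter_upwards [hloc t] with s hs
      rw [hs, ← Finset.add_sum_erase S (fun c => q c s) ht, abs_pow_three_eq]
      simp only [q]
      ring
    · exact (analyticAt_pencilTrace hA hB (hunit t ht)).contDiffAt.sub
        (ContDiffAt.sum fun c hc => hq c t fun h => ht (h ▸ hc))
  exact hasDistribDerivMeasure_four_of_eq_add_sum hg (fun t => (sub_add_cancel _ _).symm)
    (fun c _ => hC c) hpos
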